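/- Let $\alpha\ge \tfrac13$, $\beta\in(0,\tfrac1\alpha)$, $\epsilon\in(0,\min(1,\beta))$ and $K,L\in\mathbb R$. Then there is a constant $C=C(\alpha,\beta,\epsilon,K,L)>0$ with the following property. Let $M_0\subset\mathbb R^2$ be a smooth, strictly convex (that is, of positive curvature), complete, non-compact embedded curve whose two ends are asymptotic to the lines $\{x_1=-1\}$ and $\{x_1=1\}$ as $x_2\to+\infty$, and let $M_t=X(\mathbb R,t)$, $t\in[0,\infty)$, be a smooth strictly convex complete solution of the $\alpha$-curve shortening flow with initial curve $M_0$, that is $$\partial_t X(p,t)=\bar\kappa^\alpha(p,t)\,n(p,t),$$ where $\bar\kappa>0$ is the curvature of $M_t$ at $X(p,t)$ and $n$ is the unit normal pointing into the convex hull of $M_t$ (smoothness in $(p,t)$ is required for $t>0$ only, with continuity up to $t=0$). Put $u:=\bar\kappa^\alpha$, let $u_s,u_{ss}$ denote its first and second derivatives with respect to the arc length $s$ of $M_t$, and let $B_r=\{x\in\mathbb R^2:|x|<r\}$. Suppose that for all $t\ge0$ $$|u_s|\le K\,u^\beta\quad\text{and}\quad u\le L\qquad\text{at all points of } M_t\cap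 B_1 .$$ Then for all $t>0$ $$|u_{ss}|\le C\,(1+t^{-1/2})\,u^{\min(\beta,\,2\beta-1)-\epsilon}\qquad\text{at all points of } M_t\cap B_{1/2}.$$ -/

import Mathlib

open scoped ContDiff

noncomputable section

/-- The Euclidean plane. -/
abbrev Plane : Type := EuclideanSpace ℝ (Fin 2)

/-- The rotation of the plane by the angle `π / 2`, counterclockwise. -/
def rotate (v : Plane) : Plane := !₂[-(v 1), v 0]

/-- The derivative `∂_s f` of a function `f` along a parametrized curve `γ` with respect to the
arc length `s` of `γ`, that is `∂_s = |γ'|⁻¹ ∂_p`. -/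
def arcDeriv {F : Type*} [NormedAddCommGroup F] [NormedSpace ℝ F]
    (γ : ℝ → Plane) (f : ℝ → F) (p : ℝ) : F :=
  ‖deriv γ p‖⁻¹ • deriv f p

/-- The unit tangent vector `∂_s γ`. -/
def unitTangent (γ : ℝ → Plane) (p : ℝ) : Plane := arcDeriv γ γ p

/-- The unit normal vector, to the left of the unit tangent vector. On a convex curve that is
oriented so as to have positive curvature it points into the convex hull. -/
def unitNormal (γ : ℝ → Plane) (p : ℝ) : Plane := rotate (unitTangent γ p)

/-- The (signed) curvature `⟨∂_s ∂_s γ, n⟩` of a parametrized plane curve. -/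
def curvature (γ : ℝ → Plane) (p : ℝ) : ℝ :=
  inner ℝ (arcDeriv γ (unitTangent γ) p) (unitNormal γ p)

/-- `γ` is a parametrization of a smooth, strictly convex, complete, non-compact embedded plane
curve: a smooth immersion and a closed embedding of the real line, whose image bounds its convex
hull, oriented so that the curvature is positive. -/
structure IsStrictlyConvexCompleteCurve (γ : ℝ → Plane) : Prop where
  contDiff : ContDiff ℝ ∞ γ
  immersion : ∀ p, deriv γ p ≠ 0
  isClosedEmbedding : Topology.IsClosedEmbedding γ
  convex : frontier (convexHull ℝ (Set.range γ)) = Set.range γ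
  curvature_pos : ∀ p, 0 < curvature γ p

/-- The two ends of `γ` are asymptotic to the lines `x₁ = -1` and `x₁ = 1` as `x₂ → +∞`.
(A curve of positive curvature that opens upwards runs from left to right.) -/
structure EndsAsymptoticToLines (γ : ℝ → Plane) : Prop where
  left_fst : Filter.Tendsto (fun p => γ p 0) Filter.atBot (nhds (-1))
  left_snd : Filter.Tendsto (fun p => γ p 1) Filter.atBot Filter.atTop
  right_fst : Filter.Tendsto (fun p => γ p 0) Filter.atTop (nhds 1)
  right_snd : Filter.Tendsto (fun p => γ p 1) Filter.atTop Filter.atTop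

/-- `X = X(p, t)` is a strictly convex complete solution, for all times `t ≥ 0`, of the
`α`-curve shortening flow `∂_t X = κ ^ α n`. It is smooth for `t > 0` and attains its initial
curve `X(·, 0)` continuously. -/
structure IsAlphaCSF (α : ℝ) (X : ℝ → ℝ → Plane) : Prop where
  continuousOn : ContinuousOn (Function.uncurry X) (Set.univ ×ˢ Set.Ici 0)
  contDiffOn : ContDiffOn ℝ ∞ (Function.uncurry X) (Set.univ ×ˢ Set.Ioi 0)
  slice : ∀ t, 0 ≤ t → IsStrictlyConvexCompleteCurve (fun p => X p t)
  flow : ∀ p t, 0 < t →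
    HasDerivAt (fun τ => X p τ)
      (curvature (fun q => X q t) p ^ α • unitNormal (fun q => X q t) p) t

/-- The speed `u = κ ^ α` at time `t`, as a function of the parameter `p`. -/
def speed (α : ℝ) (X : ℝ → ℝ → Plane) (t p : ℝ) : ℝ :=
  curvature (fun q => X q t) p ^ α

/-- The first arc-length derivative `u_s` of the speed at time `t`. -/
def speedS (α : ℝ) (X : ℝ → ℝ → Plane) (t p : ℝ) : ℝ :=
  arcDeriv (fun q => X q t) (speed α X t) p

/-- The second arc-length derivative `u_ss` of the speed at time `t`. -/
def speedSS (α : ℝ) (X : ℝ → ℝ → Plane) (t p : ℝ) : ℝ :=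
  arcDeriv (fun q => X q t) (speedS α X t) p

end

/-! The proof is Bernstein's method. Let γ = min(β, 2β-1), η = 9/16 - |X|², A = u^(1-1/α), and bound
F = η² (t-t₁) u_ss² u^(-2γ) exp(l u_s² u^(-2β)) on the space-time region where |X| ≤ 3/4 and t₁ ≤ t
≤ t₀. The flow gives u_t = αA (u_ss + κ² u), and the commutator of ∂_t and ∂_s yields similar
equations for u_s and u_ss.

A positive maximum of F lies where η > 0 and t > t₁. There (log F)_s = 0 and (∂_t - αA ∂_s²) log F ≥
0. Write z = u_s u^(-β) and W = u_ss u^(-β), so |z| ≤ B. After division by αA the exponential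
contributes -2lW². The only other term of full order W² is 2 (u_sss/u_ss)²; the first-order
condition makes u_sss/u_ss equal to -lzW up to lower order, so with l = 1/(4B²) this term costs
about lW²/2 (`exists_bernstein_constant`). Hence W cannot dominate all the lower-order terms at
once: |W| ≤ M u^(β-1), or η|W| ≤ M, or (t-t₁) A W² ≤ M (`exists_bernstein_alternative`). In each
case F is at most a constant times a nonnegative power of u, which is bounded.

The maximum exists because the speed bound keeps the relevant parameters in a compact set
(`isCompact_setOf_norm_le`). The theorem follows with t₁ = t - min(1, t/2). The exponent γ itself is
reached; the loss of ε only costs a bounded factor u^ε. -/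

/-! ### Calculus of functions of `(t, p)` that are smooth for `t > 0` -/

/-- `f = f(t, p)` is jointly smooth for `t > 0`. -/
def SmoothPos (f : ℝ → ℝ → ℝ) : Prop :=
  ContDiffOn ℝ ∞ (Function.uncurry f) (Set.Ioi 0 ×ˢ Set.univ)

/-- The partial derivative in the space parameter. -/
noncomputable def dp (f : ℝ → ℝ → ℝ) (t p : ℝ) : ℝ := deriv (f t) p

/-- The partial derivative in time. -/
noncomputable def dt (f : ℝ → ℝ → ℝ) (t p : ℝ) : ℝ := deriv (fun τ => f τ p) t

theorem isOpen_posTimes : IsOpen ((Set.Ioi (0 : ℝ)) ×ˢ (Set.univ : Set ℝ)) :=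
  isOpen_Ioi.prod isOpen_univ

theorem mem_posTimes {t p : ℝ} (ht : 0 < t) :
    (t, p) ∈ (Set.Ioi (0 : ℝ)) ×ˢ (Set.univ : Set ℝ) := ⟨ht, trivial⟩

theorem dp_congr {f h : ℝ → ℝ → ℝ} (H : ∀ t p, 0 < t → f t p = h t p) {t p : ℝ} (ht : 0 < t) :
    dp f t p = dp h t p := by
  have : f t = h t := funext fun q => H t q ht
  simp [dp, this]

theorem dt_congr {f h : ℝ → ℝ → ℝ} (H : ∀ t p, 0 < t → f t p = h t p) {t p : ℝ} (ht : 0 < t) :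
    dt f t p = dt h t p := by
  refine Filter.EventuallyEq.deriv_eq ?_
  filter_upwards [lt_mem_nhds ht] with τ hτ using H τ p hτ

namespace SmoothPos

variable {f h : ℝ → ℝ → ℝ} {t p : ℝ}

theorem contDiffAt (hf : SmoothPos f) (ht : 0 < t) :
    ContDiffAt ℝ ∞ (Function.uncurry f) (t, p) :=
  ContDiffOn.contDiffAt hf (isOpen_posTimes.mem_nhds (mem_posTimes ht))

theorem hasFDerivAt (hf : SmoothPos f) (ht : 0 < t) :
    HasFDerivAt (Function.uncurry f) (fderiv ℝ (Function.uncurry f) (t, p)) (t, p) :=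
  ((hf.contDiffAt ht).differentiableAt (by simp)).hasFDerivAt

theorem hasDerivAt_fst_fderiv (hf : SmoothPos f) (ht : 0 < t) :
    HasDerivAt (fun τ => f τ p) (fderiv ℝ (Function.uncurry f) (t, p) (1, 0)) t := by
  have h1 : HasDerivAt (fun τ : ℝ => (τ, p)) ((1 : ℝ), (0 : ℝ)) t :=
    (hasDerivAt_id t).prodMk (hasDerivAt_const t p)
  exact HasFDerivAt.comp_hasDerivAt (f := fun τ : ℝ => (τ, p)) t (hf.hasFDerivAt ht) h1

theorem hasDerivAt_snd_fderiv (hf : SmoothPos f) (ht : 0 < t) :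
    HasDerivAt (f t) (fderiv ℝ (Function.uncurry f) (t, p) (0, 1)) p := by
  have h1 : HasDerivAt (fun q : ℝ => (t, q)) ((0 : ℝ), (1 : ℝ)) p :=
    (hasDerivAt_const p t).prodMk (hasDerivAt_id p)
  exact HasFDerivAt.comp_hasDerivAt (f := fun q : ℝ => (t, q)) p (hf.hasFDerivAt ht) h1

theorem dt_eq (hf : SmoothPos f) (ht : 0 < t) :
    dt f t p = fderiv ℝ (Function.uncurry f) (t, p) (1, 0) :=
  (hf.hasDerivAt_fst_fderiv ht).deriv

theorem dp_eq (hf : SmoothPos f) (ht : 0 < t) :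
    dp f t p = fderiv ℝ (Function.uncurry f) (t, p) (0, 1) :=
  (hf.hasDerivAt_snd_fderiv ht).deriv

theorem hasDerivAt_dt (hf : SmoothPos f) (ht : 0 < t) :
    HasDerivAt (fun τ => f τ p) (dt f t p) t := by
  rw [hf.dt_eq ht]; exact hf.hasDerivAt_fst_fderiv ht

theorem hasDerivAt_dp (hf : SmoothPos f) (ht : 0 < t) : HasDerivAt (f t) (dp f t p) p := by
  rw [hf.dp_eq ht]; exact hf.hasDerivAt_snd_fderiv ht

theorem fderiv_contDiffOn (hf : SmoothPos f) :
    ContDiffOn ℝ ∞ (fderiv ℝ (Function.uncurry f)) (Set.Ioi 0 ×ˢ Set.univ) :=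
  ContDiffOn.fderiv_of_isOpen hf isOpen_posTimes (by simp)

theorem smooth_dp (hf : SmoothPos f) : SmoothPos (dp f) := by
  have h1 : ContDiffOn ℝ ∞ (fun z => fderiv ℝ (Function.uncurry f) z (0, 1))
      (Set.Ioi 0 ×ˢ Set.univ) := hf.fderiv_contDiffOn.clm_apply contDiffOn_const
  exact h1.congr fun z hz => hf.dp_eq hz.1

/-- Symmetry of the second derivative; every evolution equation below comes from applying it to the
position, the tangent or the speed. -/
theorem dt_dp_comm (hf : SmoothPos f) (ht : 0 < t) : dt (dp f) t p = dp (dt f) t p := by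
  have hs : IsSymmSndFDerivAt ℝ (Function.uncurry f) (t, p) :=
    (hf.contDiffAt ht).isSymmSndFDerivAt (by
      rw [minSmoothness_of_isRCLikeNormedField]; exact WithTop.coe_le_coe.2 le_top)
  have hd : HasFDerivAt (fderiv ℝ (Function.uncurry f))
      (fderiv ℝ (fderiv ℝ (Function.uncurry f)) (t, p)) (t, p) :=
    ((hf.fderiv_contDiffOn.contDiffAt (isOpen_posTimes.mem_nhds
      (mem_posTimes ht))).differentiableAt (by simp)).hasFDerivAt
  have e1 : dt (dp f) t p
      = fderiv ℝ (fderiv ℝ (Function.uncurry f)) (t, p) (1, 0) (0, 1) := by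
    rw [dt_congr (h := fun τ q => fderiv ℝ (Function.uncurry f) (τ, q) (0, 1))
      (fun τ q hτ => hf.dp_eq hτ) ht]
    have h1 : HasDerivAt (fun τ : ℝ => (τ, p)) ((1 : ℝ), (0 : ℝ)) t :=
      (hasDerivAt_id t).prodMk (hasDerivAt_const t p)
    have h2 := (HasFDerivAt.comp_hasDerivAt (f := fun τ : ℝ => (τ, p)) t hd h1).clm_apply
      (hasDerivAt_const t ((0 : ℝ), (1 : ℝ)))
    simpa [dt, dp] using h2.deriv
  have e2 : dp (dt f) t p
      = fderiv ℝ (fderiv ℝ (Function.uncurry f)) (t, p) (0, 1) (1, 0) := by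
    rw [dp_congr (h := fun τ q => fderiv ℝ (Function.uncurry f) (τ, q) (1, 0))
      (fun τ q hτ => hf.dt_eq hτ) ht]
    have h1 : HasDerivAt (fun q : ℝ => (t, q)) ((0 : ℝ), (1 : ℝ)) p :=
      (hasDerivAt_const p t).prodMk (hasDerivAt_id p)
    have h2 := (HasFDerivAt.comp_hasDerivAt (f := fun q : ℝ => (t, q)) p hd h1).clm_apply
      (hasDerivAt_const p ((1 : ℝ), (0 : ℝ)))
    simpa [dt, dp] using h2.deriv
  rw [e1, e2]
  exact hs _ _

theorem congr (hf : SmoothPos f) (H : ∀ t p, 0 < t → h t p = f t p) : SmoothPos h :=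
  ContDiffOn.congr hf fun z hz => H z.1 z.2 hz.1

theorem add (hf : SmoothPos f) (hh : SmoothPos h) : SmoothPos fun t p => f t p + h t p :=
  ContDiffOn.add hf hh

theorem sub (hf : SmoothPos f) (hh : SmoothPos h) : SmoothPos fun t p => f t p - h t p :=
  ContDiffOn.sub hf hh

theorem mul (hf : SmoothPos f) (hh : SmoothPos h) : SmoothPos fun t p => f t p * h t p :=
  ContDiffOn.mul hf hh

theorem inv (hf : SmoothPos f) (h0 : ∀ t p, 0 < t → f t p ≠ 0) :
    SmoothPos fun t p => (f t p)⁻¹ :=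
  ContDiffOn.inv hf fun z hz => h0 z.1 z.2 hz.1

theorem sqrt (hf : SmoothPos f) (h0 : ∀ t p, 0 < t → f t p ≠ 0) :
    SmoothPos fun t p => √(f t p) :=
  ContDiffOn.sqrt hf fun z hz => h0 z.1 z.2 hz.1

theorem rpow (hf : SmoothPos f) (h0 : ∀ t p, 0 < t → f t p ≠ 0) (a : ℝ) :
    SmoothPos fun t p => f t p ^ a :=
  ContDiffOn.rpow_const_of_ne hf fun z hz => h0 z.1 z.2 hz.1

end SmoothPos

/-! ### Geometry of a solution -/

theorem hasDerivAt_apply {γ : ℝ → Plane} {p : ℝ} {v : Plane} (h : HasDerivAt γ v p) (i : Fin 2) :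
    HasDerivAt (fun q => γ q i) (v i) p :=
  ((EuclideanSpace.proj (𝕜 := ℝ) i).hasFDerivAt.comp_hasDerivAt p h :)

theorem inner_plane (v w : Plane) : inner ℝ v w = v 0 * w 0 + v 1 * w 1 := by
  simp [PiLp.inner_apply, Fin.sum_univ_two, mul_comm]

theorem norm_sq_plane (v : Plane) : ‖v‖ ^ 2 = v 0 ^ 2 + v 1 ^ 2 := by
  simp [EuclideanSpace.norm_sq_eq, Fin.sum_univ_two]

/-- The Frenet equations of a parametrized curve, in coordinates. -/
theorem frenet {γ : ℝ → Plane} {p : ℝ} (h0 : ∀ q, deriv γ q ≠ 0)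
    (hd : DifferentiableAt ℝ (unitTangent γ) p) :
    (unitTangent γ p 0) ^ 2 + (unitTangent γ p 1) ^ 2 = 1 ∧
    HasDerivAt (fun q => unitTangent γ q 0)
      (-(curvature γ p * ‖deriv γ p‖ * unitTangent γ p 1)) p ∧
    HasDerivAt (fun q => unitTangent γ q 1)
      (curvature γ p * ‖deriv γ p‖ * unitTangent γ p 0) p := by
  have hg : ∀ q, ‖deriv γ q‖ ≠ 0 := fun q => norm_ne_zero_iff.2 (h0 q)
  have hu : ∀ q, (unitTangent γ q 0) ^ 2 + (unitTangent γ q 1) ^ 2 = 1 := fun q => by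
    rw [← norm_sq_plane, unitTangent, arcDeriv, norm_smul, norm_inv, norm_norm,
      inv_mul_cancel₀ (hg q), one_pow]
  have hT := hd.hasDerivAt
  set T' := deriv (unitTangent γ) p with hT'
  have hT0 := hasDerivAt_apply hT 0
  have hT1 := hasDerivAt_apply hT 1
  have hk : curvature γ p * ‖deriv γ p‖
      = T' 1 * unitTangent γ p 0 - T' 0 * unitTangent γ p 1 := by
    rw [curvature, inner_plane]
    simp only [arcDeriv, unitNormal, rotate, ← hT']
    have := hg p
    simp
    field_simp
    ring
  have horth : T' 0 * unitTangent γ p 0 + T' 1 * unitTangent γ p 1 = 0 := by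
    have h1 := (hT0.pow 2).add (hT1.pow 2)
    have h2 : HasDerivAt ((fun q => unitTangent γ q 0) ^ 2 + (fun q => unitTangent γ q 1) ^ 2)
        0 p := by
      have : ((fun q => unitTangent γ q 0) ^ 2 + (fun q => unitTangent γ q 1) ^ 2)
          = fun _ => (1 : ℝ) := funext fun q => by simpa using hu q
      rw [this]; exact hasDerivAt_const _ _
    have h3 := h1.unique h2
    push_cast at h3
    linarith
  refine ⟨hu p, ?_, ?_⟩
  · convert hT0 using 1
    rw [hk]
    linear_combination (T' 0) * (hu p) - unitTangent γ p 0 * horth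
  · convert hT1 using 1
    rw [hk]
    linear_combination (T' 1) * (hu p) - unitTangent γ p 1 * horth

/-- The length element `|∂_p X|`. -/
noncomputable def lengthElement (X : ℝ → ℝ → Plane) (t p : ℝ) : ℝ :=
  ‖deriv (fun q => X q t) p‖

/-- The `i`-th coordinate of the unit tangent vector. -/
noncomputable def tangentCoord (X : ℝ → ℝ → Plane) (i : Fin 2) (t p : ℝ) : ℝ :=
  unitTangent (fun q => X q t) p i

/-- The curvature as a function of `(t, p)`. -/
noncomputable def curv (X : ℝ → ℝ → Plane) (t p : ℝ) : ℝ := curvature (fun q => X q t) p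

/-- The arc length derivative of a function of `(t, p)`. -/
noncomputable def ds (X : ℝ → ℝ → Plane) (f : ℝ → ℝ → ℝ) (t p : ℝ) : ℝ :=
  (lengthElement X t p)⁻¹ * dp f t p

theorem speedS_eq (α : ℝ) (X : ℝ → ℝ → Plane) : speedS α X = ds X (speed α X) := rfl

theorem speedSS_eq (α : ℝ) (X : ℝ → ℝ → Plane) : speedSS α X = ds X (speedS α X) := rfl

namespace IsAlphaCSF

variable {α : ℝ} {X : ℝ → ℝ → Plane} {t p : ℝ}

theorem smooth_coord (hX : IsAlphaCSF α X) (i : Fin 2) : SmoothPos fun t p => X p t i := by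
  have h1 : ContDiffOn ℝ ∞ (fun z : ℝ × ℝ => Function.uncurry X (z.2, z.1))
      (Set.Ioi 0 ×ˢ Set.univ) :=
    hX.contDiffOn.comp (contDiff_snd.prodMk contDiff_fst).contDiffOn
      fun z hz => ⟨trivial, hz.1⟩
  exact ((EuclideanSpace.proj (𝕜 := ℝ) i).contDiff.comp_contDiffOn h1 :)

theorem lengthElement_pos (hX : IsAlphaCSF α X) (ht : 0 ≤ t) : 0 < lengthElement X t p :=
  norm_pos_iff.2 ((hX.slice t ht).immersion p)

theorem deriv_coord (hX : IsAlphaCSF α X) (ht : 0 ≤ t) (i : Fin 2) :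
    deriv (fun q => X q t) p i = dp (fun t p => X p t i) t p :=
  (hasDerivAt_apply (((hX.slice t ht).contDiff.differentiable (by simp) p).hasDerivAt) i).deriv.symm

theorem smooth_lengthElement (hX : IsAlphaCSF α X) : SmoothPos (lengthElement X) := by
  have key : ∀ t p, 0 < t → lengthElement X t p
      = √(dp (fun t p => X p t 0) t p * dp (fun t p => X p t 0) t p +
        dp (fun t p => X p t 1) t p * dp (fun t p => X p t 1) t p) := fun t p ht => by
    rw [← hX.deriv_coord ht.le, ← hX.deriv_coord ht.le, ← sq, ← sq, ← norm_sq_plane,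
      Real.sqrt_sq (norm_nonneg _)]
    rfl
  have h0 := (hX.smooth_coord 0).smooth_dp
  have h1 := (hX.smooth_coord 1).smooth_dp
  refine (((h0.mul h0).add (h1.mul h1)).sqrt fun t p ht h => ?_).congr key
  have := hX.lengthElement_pos (p := p) ht.le
  rw [key t p ht, h, Real.sqrt_zero] at this
  exact lt_irrefl _ this

theorem tangentCoord_eq (hX : IsAlphaCSF α X) (ht : 0 ≤ t) (i : Fin 2) :
    tangentCoord X i t p = ds X (fun t p => X p t i) t p := by
  rw [ds, ← hX.deriv_coord ht]
  simp [tangentCoord, unitTangent, arcDeriv, lengthElement]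

theorem smooth_ds (hX : IsAlphaCSF α X) {f : ℝ → ℝ → ℝ} (hf : SmoothPos f) :
    SmoothPos (ds X f) :=
  (hX.smooth_lengthElement.inv fun _ _ ht => (hX.lengthElement_pos ht.le).ne').mul hf.smooth_dp

theorem smooth_tangentCoord (hX : IsAlphaCSF α X) (i : Fin 2) : SmoothPos (tangentCoord X i) :=
  (hX.smooth_ds (hX.smooth_coord i)).congr fun _ _ ht => hX.tangentCoord_eq ht.le i

theorem frenet (hX : IsAlphaCSF α X) (ht : 0 < t) :
    tangentCoord X 0 t p ^ 2 + tangentCoord X 1 t p ^ 2 = 1 ∧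
    dp (tangentCoord X 0) t p = -(curv X t p * lengthElement X t p * tangentCoord X 1 t p) ∧
    dp (tangentCoord X 1) t p = curv X t p * lengthElement X t p * tangentCoord X 0 t p := by
  have hd : DifferentiableAt ℝ (unitTangent fun q => X q t) p := by
    rw [differentiableAt_euclidean]
    intro i
    exact ((hX.smooth_tangentCoord i).hasDerivAt_dp ht).differentiableAt
  obtain ⟨h1, h2, h3⟩ := _root_.frenet (hX.slice t ht.le).immersion hd
  exact ⟨h1, h2.deriv, h3.deriv⟩

/-- The Frenet equations express κ as the cross product of T and T_s, whose coordinates are already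
known to be smooth. -/
theorem smooth_curv (hX : IsAlphaCSF α X) : SmoothPos (curv X) := by
  have h := ((hX.smooth_ds (hX.smooth_tangentCoord 1)).mul (hX.smooth_tangentCoord 0)).sub
    ((hX.smooth_ds (hX.smooth_tangentCoord 0)).mul (hX.smooth_tangentCoord 1))
  refine h.congr fun t p ht => ?_
  obtain ⟨h1, h2, h3⟩ := hX.frenet (p := p) ht
  have := (hX.lengthElement_pos (p := p) ht.le).ne'
  simp only [ds, h2, h3]
  field_simp
  linear_combination (-curv X t p) * h1

theorem curv_pos (hX : IsAlphaCSF α X) (ht : 0 ≤ t) : 0 < curv X t p :=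
  (hX.slice t ht).curvature_pos p

theorem speed_pos (hX : IsAlphaCSF α X) (ht : 0 ≤ t) : 0 < speed α X t p :=
  Real.rpow_pos_of_pos (hX.curv_pos ht) _

theorem smooth_speed (hX : IsAlphaCSF α X) : SmoothPos (speed α X) :=
  hX.smooth_curv.rpow (fun _ _ ht => (hX.curv_pos ht.le).ne') α

theorem smooth_speedS (hX : IsAlphaCSF α X) : SmoothPos (speedS α X) :=
  hX.smooth_ds hX.smooth_speed

theorem smooth_speedSS (hX : IsAlphaCSF α X) : SmoothPos (speedSS α X) :=
  hX.smooth_ds hX.smooth_speedS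

theorem dp_eq_ds (hX : IsAlphaCSF α X) (ht : 0 < t) (f : ℝ → ℝ → ℝ) :
    dp f t p = lengthElement X t p * ds X f t p := by
  rw [ds, mul_inv_cancel_left₀ (hX.lengthElement_pos ht.le).ne']

theorem dt_coord (hX : IsAlphaCSF α X) (ht : 0 < t) :
    dt (fun t p => X p t 0) t p = -(speed α X t p * tangentCoord X 1 t p) ∧
    dt (fun t p => X p t 1) t p = speed α X t p * tangentCoord X 0 t p := by
  have h := hX.flow p t ht
  have e0 := (hasDerivAt_apply h 0).deriv
  have e1 := (hasDerivAt_apply h 1).deriv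
  constructor
  · refine e0.trans ?_
    simp [unitNormal, rotate, speed, tangentCoord]
  · refine e1.trans ?_
    simp [unitNormal, rotate, speed, tangentCoord]

/-- Evolution of the length element and of the unit tangent vector. -/
theorem dt_lengthElement_tangentCoord (hX : IsAlphaCSF α X) (ht : 0 < t) :
    dt (lengthElement X) t p = -(curv X t p * speed α X t p * lengthElement X t p) ∧
    dt (tangentCoord X 0) t p = -(speedS α X t p * tangentCoord X 1 t p) ∧
    dt (tangentCoord X 1) t p = speedS α X t p * tangentCoord X 0 t p := by
  have hg := hX.smooth_lengthElement.hasDerivAt_dt (p := p) ht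
  have hT0 := (hX.smooth_tangentCoord 0).hasDerivAt_dt (p := p) ht
  have hT1 := (hX.smooth_tangentCoord 1).hasDerivAt_dt (p := p) ht
  have hu := hX.smooth_speed.hasDerivAt_dp (p := p) ht
  have hT0p := (hX.smooth_tangentCoord 0).hasDerivAt_dp (p := p) ht
  have hT1p := (hX.smooth_tangentCoord 1).hasDerivAt_dp (p := p) ht
  have hgpos := hX.lengthElement_pos (p := p) ht.le
  have hx : ∀ i : Fin 2, ∀ t p, 0 < t → dp (fun t p => X p t i) t p
      = lengthElement X t p * tangentCoord X i t p := fun i t p ht => by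
    rw [hX.tangentCoord_eq ht.le, hX.dp_eq_ds ht]
  -- Both sides of ∂_t ∂_p X = ∂_p ∂_t X, with ∂_p X = g T and ∂_t X = u n. The tangential component
  -- gives g_t, since T_t is orthogonal to T; what remains gives T_t.
  have c0 := (hX.smooth_coord 0).dt_dp_comm (p := p) ht
  have c1 := (hX.smooth_coord 1).dt_dp_comm (p := p) ht
  rw [dt_congr (hx 0) ht, dp_congr (fun t p ht => (hX.dt_coord ht).1) ht] at c0
  rw [dt_congr (hx 1) ht, dp_congr (fun t p ht => (hX.dt_coord ht).2) ht] at c1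
  rw [dt, dp, (hg.fun_mul hT0).deriv, (hu.fun_mul hT1p).fun_neg.deriv] at c0
  rw [dt, dp, (hg.fun_mul hT1).deriv, (hu.fun_mul hT0p).deriv] at c1
  obtain ⟨h1, h2, h3⟩ := hX.frenet (p := p) ht
  have horth : tangentCoord X 0 t p * dt (tangentCoord X 0) t p +
      tangentCoord X 1 t p * dt (tangentCoord X 1) t p = 0 := by
    have e := (((hT0.mul hT0).add (hT1.mul hT1)).congr_of_eventuallyEq
      (f₁ := fun _ => (1 : ℝ)) (by
        filter_upwards [lt_mem_nhds ht] with τ hτ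
        have := (hX.frenet (p := p) hτ).1
        simp only [Pi.add_apply, Pi.mul_apply]
        linarith)).unique (hasDerivAt_const t (1 : ℝ))
    linarith
  rw [h3] at c0
  rw [h2] at c1
  rw [hX.dp_eq_ds ht (speed α X), ← speedS_eq] at c0 c1
  set g := lengthElement X t p
  set c := tangentCoord X 0 t p
  set σ := tangentCoord X 1 t p
  set u := speed α X t p
  set k := curv X t p
  set v := speedS α X t p
  set g' := dt (lengthElement X) t p
  set c' := dt (tangentCoord X 0) t p
  set σ' := dt (tangentCoord X 1) t p
  have a1 : g' = -(k * u * g) := by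
    linear_combination c * c0 + σ * c1 - g * horth - (g' + k * u * g) * h1
  rw [a1] at c0 c1
  refine ⟨a1, mul_left_cancel₀ hgpos.ne' ?_, mul_left_cancel₀ hgpos.ne' ?_⟩
  · linear_combination c0
  · linear_combination c1

/-- The commutator of the time derivative and the arc length derivative. -/
theorem dt_ds (hX : IsAlphaCSF α X) (ht : 0 < t) {f : ℝ → ℝ → ℝ} (hf : SmoothPos f) :
    dt (ds X f) t p = ds X (dt f) t p + curv X t p * speed α X t p * ds X f t p := by
  have hg := hX.smooth_lengthElement.hasDerivAt_dt (p := p) ht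
  have hgpos := hX.lengthElement_pos (p := p) ht.le
  have h1 := (hg.inv hgpos.ne').mul (hf.smooth_dp.hasDerivAt_dt (p := p) ht)
  have h2 := h1.deriv
  change dt (ds X f) t p = _ at h2
  rw [h2, hf.dt_dp_comm ht, (hX.dt_lengthElement_tangentCoord ht).1]
  simp only [ds, Pi.inv_apply]
  field_simp
  ring

/-- Evolution of the curvature. -/
theorem dt_curv (hX : IsAlphaCSF α X) (ht : 0 < t) :
    dt (curv X) t p = speedSS α X t p + curv X t p ^ 2 * speed α X t p := by
  have hgpos := hX.lengthElement_pos (p := p) ht.le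
  have hg := hX.smooth_lengthElement.hasDerivAt_dt (p := p) ht
  have hk := hX.smooth_curv.hasDerivAt_dt (p := p) ht
  have hT0 := (hX.smooth_tangentCoord 0).hasDerivAt_dt (p := p) ht
  have hT1 := (hX.smooth_tangentCoord 1).hasDerivAt_dt (p := p) ht
  have hT0p := (hX.smooth_tangentCoord 0).hasDerivAt_dp (p := p) ht
  have hT1p := (hX.smooth_tangentCoord 1).hasDerivAt_dp (p := p) ht
  have hv := hX.smooth_speedS.hasDerivAt_dp (p := p) ht
  -- The same comparison for T, with T_p = κ g n and T_t = u_s n; the normal component isolates κ_t.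
  have c0 := (hX.smooth_tangentCoord 0).dt_dp_comm (p := p) ht
  have c1 := (hX.smooth_tangentCoord 1).dt_dp_comm (p := p) ht
  rw [dt_congr (fun t p ht => (hX.frenet ht).2.1) ht,
    dp_congr (fun t p ht => (hX.dt_lengthElement_tangentCoord ht).2.1) ht] at c0
  rw [dt_congr (fun t p ht => (hX.frenet ht).2.2) ht,
    dp_congr (fun t p ht => (hX.dt_lengthElement_tangentCoord ht).2.2) ht] at c1
  rw [dt, dp, ((hk.fun_mul hg).fun_mul hT1).fun_neg.deriv, (hv.fun_mul hT1p).fun_neg.deriv] at c0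
  rw [dt, dp, ((hk.fun_mul hg).fun_mul hT0).deriv, (hv.fun_mul hT0p).deriv] at c1
  obtain ⟨h1, h2, h3⟩ := hX.frenet (p := p) ht
  obtain ⟨e1, e2, e3⟩ := hX.dt_lengthElement_tangentCoord (p := p) ht
  rw [h3, e1, e3, hX.dp_eq_ds ht (speedS α X), ← speedSS_eq] at c0
  rw [h2, e1, e2, hX.dp_eq_ds ht (speedS α X), ← speedSS_eq] at c1
  refine mul_left_cancel₀ hgpos.ne' ?_
  set g := lengthElement X t p
  set c := tangentCoord X 0 t p
  set σ := tangentCoord X 1 t p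
  set u := speed α X t p
  set k := curv X t p
  set w := speedSS α X t p
  linear_combination c * c1 - σ * c0 - g * (dt (curv X) t p - k ^ 2 * u - w) * h1

end IsAlphaCSF

/-! ### Derivative tests at a maximum -/

/-- Writing f^a / f instead of f^(a-1) keeps each real power a single atom, so that later identities
are rational. -/
theorem HasDerivAt.rpow_const_div {f : ℝ → ℝ} {f' x : ℝ} (hf : HasDerivAt f f' x) (h0 : 0 < f x)
    (a : ℝ) : HasDerivAt (fun y => f y ^ a) (a * (f x ^ a / f x) * f') x := by
  convert hf.rpow_const (p := a) (Or.inl h0.ne') using 1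
  rw [Real.rpow_sub_one h0.ne']
  ring

/-- A one-sided first derivative test. -/
theorem HasDerivAt.nonneg_of_eventually_le_left {f : ℝ → ℝ} {f' t : ℝ} (hf : HasDerivAt f f' t)
    (h : ∀ᶠ τ in nhdsWithin t (Set.Iio t), f τ ≤ f t) : 0 ≤ f' := by
  have h1 := hf.hasDerivWithinAt (s := Set.Iio t)
  rw [hasDerivWithinAt_iff_tendsto_slope' (by simp)] at h1
  refine ge_of_tendsto h1 ?_
  filter_upwards [h, self_mem_nhdsWithin] with τ hτ hlt
  rw [slope_def_field]
  exact div_nonneg_of_nonpos (by linarith) (by linarith [Set.mem_Iio.1 hlt])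

/-- The second derivative test at a local maximum, for the derivation `g⁻¹ ∂_p`. -/
theorem IsLocalMax.arcLength_second_deriv_nonpos {f g d : ℝ → ℝ} {e g' p : ℝ}
    (hmax : IsLocalMax f p) (hg0 : 0 < g p) (hg : HasDerivAt g g' p)
    (hf : ∀ᶠ q in nhds p, HasDerivAt f (g q * d q) q) (hd : HasDerivAt d (g p * e) p) :
    d p = 0 ∧ e ≤ 0 := by
  have hfp := hf.self_of_nhds
  have h0 : g p * d p = 0 := hmax.hasDerivAt_eq_zero hfp
  have hdp : d p = 0 := by simpa [hg0.ne'] using h0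
  refine ⟨hdp, ?_⟩
  by_contra! hpos
  have hder : deriv f =ᶠ[nhds p] fun q => g q * d q := by
    filter_upwards [hf] with q hq using hq.deriv
  have hdd : deriv (deriv f) p = g p * (g p * e) := by
    rw [hder.deriv_eq, (hg.fun_mul hd).deriv, hdp]
    ring
  -- If e > 0 then f'' = g² e > 0 and p is also a local minimum. Then f is locally constant, which
  -- contradicts f'' > 0.
  have hmin : IsLocalMin f p := isLocalMin_of_deriv_deriv_pos
    (by rw [hdd]; positivity) (by rw [hfp.deriv, h0]) hfp.continuousAt
  have hconst : f =ᶠ[nhds p] fun _ => f p := by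
    filter_upwards [hmin, hmax] with q h1 h2 using le_antisymm h2 h1
  have h1 : deriv f =ᶠ[nhds p] fun _ => 0 := by
    filter_upwards [hconst.eventuallyEq_nhds] with q hq
    rw [hq.deriv_eq, deriv_const]
  have h2 : deriv (deriv f) p = 0 := by rw [h1.deriv_eq, deriv_const]
  rw [hdd] at h2
  have : 0 < g p * (g p * e) := by positivity
  linarith

/-! ### Evolution of the speed, its derivatives and the cutoff -/

/-- The cutoff function `9/16 - |X|²`. -/
noncomputable def cutoff (X : ℝ → ℝ → Plane) (t p : ℝ) : ℝ := 9 / 16 - ‖X p t‖ ^ 2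

/-- The tangential component of the position vector. -/
noncomputable def tangentialPart (X : ℝ → ℝ → Plane) (t p : ℝ) : ℝ :=
  X p t 0 * tangentCoord X 0 t p + X p t 1 * tangentCoord X 1 t p

/-- The normal component of the position vector. -/
noncomputable def normalPart (X : ℝ → ℝ → Plane) (t p : ℝ) : ℝ :=
  X p t 1 * tangentCoord X 0 t p - X p t 0 * tangentCoord X 1 t p

namespace IsAlphaCSF

variable {α : ℝ} {X : ℝ → ℝ → Plane} {t p : ℝ}

theorem curv_eq (hX : IsAlphaCSF α X) (hα : 0 < α) (ht : 0 ≤ t) :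
    curv X t p = speed α X t p ^ (1 / α) := by
  change _ = (curv X t p ^ α) ^ (1 / α)
  rw [← Real.rpow_mul (hX.curv_pos ht).le, mul_one_div_cancel hα.ne', Real.rpow_one]

theorem curv_sq (hX : IsAlphaCSF α X) (hα : 0 < α) (ht : 0 ≤ t) :
    curv X t p ^ 2 = speed α X t p ^ (2 * (1 / α)) := by
  rw [hX.curv_eq hα ht, mul_comm, Real.rpow_mul (hX.speed_pos ht).le, Real.rpow_two]

theorem curv_mul_rpow (hX : IsAlphaCSF α X) (hα : 0 < α) (ht : 0 ≤ t) :
    curv X t p * speed α X t p ^ (1 - 1 / α) = speed α X t p := by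
  rw [hX.curv_eq hα ht, ← Real.rpow_add (hX.speed_pos ht), add_sub_cancel, Real.rpow_one]

/-- Gives the commutator coefficient κu the factor u^(1-1/α) common to all other terms of the
evolution equations. -/
theorem curv_mul_speed (hX : IsAlphaCSF α X) (hα : 0 < α) (ht : 0 ≤ t) :
    curv X t p * speed α X t p
      = speed α X t p ^ (1 - 1 / α) * speed α X t p ^ (2 * (1 / α)) := by
  rw [← hX.curv_sq hα ht]
  linear_combination (-curv X t p) * hX.curv_mul_rpow (p := p) hα ht

theorem hasDerivAt_ds (hX : IsAlphaCSF α X) (ht : 0 < t) {f : ℝ → ℝ → ℝ} (hf : SmoothPos f) :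
    HasDerivAt (f t) (lengthElement X t p * ds X f t p) p := by
  rw [← hX.dp_eq_ds ht]; exact hf.hasDerivAt_dp ht

theorem ds_eq_of_hasDerivAt (hX : IsAlphaCSF α X) (ht : 0 < t) {f : ℝ → ℝ → ℝ} {d : ℝ}
    (h : HasDerivAt (f t) (lengthElement X t p * d) p) : ds X f t p = d := by
  rw [ds, dp, h.deriv, inv_mul_cancel_left₀ (hX.lengthElement_pos ht.le).ne']

theorem ds_congr {f h : ℝ → ℝ → ℝ} (H : ∀ t p, 0 < t → f t p = h t p) (ht : 0 < t) :
    ds X f t p = ds X h t p := by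
  rw [ds, ds, dp_congr H ht]

/-- Evolution of the speed. -/
theorem dt_speed (hX : IsAlphaCSF α X) (hα : 0 < α) (ht : 0 < t) :
    dt (speed α X) t p = α * speed α X t p ^ (1 - 1 / α) *
      (speedSS α X t p + speed α X t p ^ (2 * (1 / α)) * speed α X t p) := by
  have h := (hX.smooth_curv.hasDerivAt_dt (p := p) ht).rpow_const_div (hX.curv_pos ht.le) α
  have h2 : dt (speed α X) t p = _ := h.deriv
  rw [h2, hX.dt_curv ht, hX.curv_sq hα ht.le]
  have h3 : curv X t p ^ α / curv X t p = speed α X t p ^ (1 - 1 / α) := by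
    rw [div_eq_iff (hX.curv_pos ht.le).ne', mul_comm, hX.curv_mul_rpow hα ht.le]
    rfl
  rw [h3]

/-- Evolution of the first arc length derivative of the speed. -/
theorem dt_speedS (hX : IsAlphaCSF α X) (hα : 0 < α) (ht : 0 < t) :
    dt (speedS α X) t p = α * speed α X t p ^ (1 - 1 / α) *
      (ds X (speedSS α X) t p
        + (1 - 1 / α) * (speedS α X t p * speedSS α X t p / speed α X t p)
        + (2 + 2 * (1 / α)) * (speed α X t p ^ (2 * (1 / α)) * speedS α X t p)) := by
  have hpos := hX.speed_pos (p := p) ht.le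
  have hu : HasDerivAt (speed α X t) (lengthElement X t p * speedS α X t p) p :=
    hX.hasDerivAt_ds ht hX.smooth_speed
  have hw := hX.hasDerivAt_ds (p := p) ht hX.smooth_speedSS
  have h1 := ((hu.rpow_const_div hpos (1 - 1 / α)).const_mul α).fun_mul
    (hw.fun_add ((hu.rpow_const_div hpos (2 * (1 / α))).fun_mul hu))
  rw [speedS_eq, hX.dt_ds ht hX.smooth_speed, ds_congr (fun t p ht => hX.dt_speed hα ht) ht,
    hX.curv_mul_speed hα ht.le, ← speedS_eq]
  have h2 := hX.ds_eq_of_hasDerivAt (f := fun t p => α * speed α X t p ^ (1 - 1 / α) *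
      (speedSS α X t p + speed α X t p ^ (2 * (1 / α)) * speed α X t p)) ht
      (h1.congr_deriv (show _ = lengthElement X t p *
        (α * speed α X t p ^ (1 - 1 / α) * ((1 - 1 / α) * (speedS α X t p / speed α X t p) *
        (speedSS α X t p + speed α X t p ^ (2 * (1 / α)) * speed α X t p) +
        (ds X (speedSS α X) t p + (1 + 2 * (1 / α)) *
          (speed α X t p ^ (2 * (1 / α)) * speedS α X t p)))) by
        generalize speed α X t p ^ (1 - 1 / α) = A, speed α X t p ^ (2 * (1 / α)) = U
        field_simp
        ring))
  rw [h2]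
  generalize speed α X t p ^ (1 - 1 / α) = A, speed α X t p ^ (2 * (1 / α)) = U
  field_simp
  ring

/-- Evolution of the second arc length derivative of the speed. -/
theorem dt_speedSS (hX : IsAlphaCSF α X) (hα : 0 < α) (ht : 0 < t) :
    dt (speedSS α X) t p = α * speed α X t p ^ (1 - 1 / α) *
      (ds X (ds X (speedSS α X)) t p
        + 2 * (1 - 1 / α) * (speedS α X t p * ds X (speedSS α X) t p / speed α X t p)
        + (1 - 1 / α) * (speedSS α X t p ^ 2 / speed α X t p)
        - 1 / α * (1 - 1 / α) * (speedS α X t p ^ 2 * speedSS α X t p / speed α X t p ^ 2)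
        + (2 + 3 * (1 / α)) * (speed α X t p ^ (2 * (1 / α)) * speedSS α X t p)
        + (2 + 2 * (1 / α)) * (1 + 1 / α) *
          (speed α X t p ^ (2 * (1 / α)) * speedS α X t p ^ 2 / speed α X t p)) := by
  have hpos := hX.speed_pos (p := p) ht.le
  have hu : HasDerivAt (speed α X t) (lengthElement X t p * speedS α X t p) p :=
    hX.hasDerivAt_ds ht hX.smooth_speed
  have hv : HasDerivAt (speedS α X t) (lengthElement X t p * speedSS α X t p) p :=
    hX.hasDerivAt_ds ht hX.smooth_speedS
  have hw := hX.hasDerivAt_ds (p := p) ht hX.smooth_speedSS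
  have hw1 := hX.hasDerivAt_ds (p := p) ht (hX.smooth_ds hX.smooth_speedSS)
  have h1 := ((hu.rpow_const_div hpos (1 - 1 / α)).const_mul α).fun_mul
    ((hw1.fun_add (((hv.fun_mul hw).fun_div hu hpos.ne').const_mul (1 - 1 / α))).fun_add
      (((hu.rpow_const_div hpos (2 * (1 / α))).fun_mul hv).const_mul (2 + 2 * (1 / α))))
  have h2 := hX.ds_eq_of_hasDerivAt (f := fun t p => α * speed α X t p ^ (1 - 1 / α) *
      (ds X (speedSS α X) t p
        + (1 - 1 / α) * (speedS α X t p * speedSS α X t p / speed α X t p)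
        + (2 + 2 * (1 / α)) * (speed α X t p ^ (2 * (1 / α)) * speedS α X t p))) ht
      (h1.congr_deriv (show _ = lengthElement X t p *
        (α * speed α X t p ^ (1 - 1 / α) * ((1 - 1 / α) * (speedS α X t p / speed α X t p) *
          (ds X (speedSS α X) t p
          + (1 - 1 / α) * (speedS α X t p * speedSS α X t p / speed α X t p)
          + (2 + 2 * (1 / α)) * (speed α X t p ^ (2 * (1 / α)) * speedS α X t p)) +
          (ds X (ds X (speedSS α X)) t p + (1 - 1 / α) *
            (speedSS α X t p ^ 2 / speed α X t p
              + speedS α X t p * ds X (speedSS α X) t p / speed α X t p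
              - speedS α X t p ^ 2 * speedSS α X t p / speed α X t p ^ 2)
          + (2 + 2 * (1 / α)) * (speed α X t p ^ (2 * (1 / α)) * speedSS α X t p
            + 2 * (1 / α) *
              (speed α X t p ^ (2 * (1 / α)) * speedS α X t p ^ 2 / speed α X t p))))) by
        generalize speed α X t p ^ (1 - 1 / α) = A, speed α X t p ^ (2 * (1 / α)) = U
        field_simp
        ring))
  rw [speedSS_eq, hX.dt_ds ht hX.smooth_speedS, ds_congr (fun t p ht => hX.dt_speedS hα ht) ht,
    hX.curv_mul_speed hα ht.le, ← speedSS_eq, h2]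
  generalize speed α X t p ^ (1 - 1 / α) = A, speed α X t p ^ (2 * (1 / α)) = U
  field_simp
  ring

theorem cutoff_eq (X : ℝ → ℝ → Plane) (t p : ℝ) :
    cutoff X t p = 9 / 16 - (X p t 0 * X p t 0 + X p t 1 * X p t 1) := by
  rw [cutoff, norm_sq_plane]; ring

theorem smooth_cutoff (hX : IsAlphaCSF α X) : SmoothPos (cutoff X) := by
  have h0 := hX.smooth_coord 0
  have h1 := hX.smooth_coord 1
  have hc : SmoothPos fun _ _ => (9 / 16 : ℝ) := contDiffOn_const
  exact (hc.sub ((h0.mul h0).add (h1.mul h1))).congr fun t p _ => cutoff_eq X t p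

theorem tangentialPart_sq_add (hX : IsAlphaCSF α X) (ht : 0 < t) :
    tangentialPart X t p ^ 2 + normalPart X t p ^ 2 = ‖X p t‖ ^ 2 := by
  rw [norm_sq_plane, tangentialPart, normalPart]
  linear_combination (X p t 0 ^ 2 + X p t 1 ^ 2) * (hX.frenet (p := p) ht).1

theorem hasDerivAt_coord (hX : IsAlphaCSF α X) (ht : 0 < t) (i : Fin 2) :
    HasDerivAt (fun q => X q t i) (lengthElement X t p * tangentCoord X i t p) p := by
  rw [hX.tangentCoord_eq ht.le]
  exact hX.hasDerivAt_ds ht (hX.smooth_coord i)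

theorem hasDerivAt_cutoff (hX : IsAlphaCSF α X) (ht : 0 < t) :
    HasDerivAt (cutoff X t) (lengthElement X t p * (-2 * tangentialPart X t p)) p := by
  have h0 := hX.hasDerivAt_coord (p := p) ht 0
  have h1 := hX.hasDerivAt_coord (p := p) ht 1
  have h := ((h0.fun_mul h0).fun_add (h1.fun_mul h1)).const_sub (9 / 16)
  rw [show cutoff X t = _ from funext fun q => cutoff_eq X t q]
  refine h.congr_deriv ?_
  rw [tangentialPart]
  ring

theorem hasDerivAt_tangentialPart (hX : IsAlphaCSF α X) (ht : 0 < t) :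
    HasDerivAt (tangentialPart X t)
      (lengthElement X t p * (1 + curv X t p * normalPart X t p)) p := by
  have h0 := hX.hasDerivAt_coord (p := p) ht 0
  have h1 := hX.hasDerivAt_coord (p := p) ht 1
  have t0 := (hX.smooth_tangentCoord 0).hasDerivAt_dp (p := p) ht
  have t1 := (hX.smooth_tangentCoord 1).hasDerivAt_dp (p := p) ht
  obtain ⟨e1, e2, e3⟩ := hX.frenet (p := p) ht
  rw [e2] at t0
  rw [e3] at t1
  refine ((h0.fun_mul t0).fun_add (h1.fun_mul t1)).congr_deriv ?_
  rw [normalPart]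
  linear_combination lengthElement X t p * e1

theorem dt_cutoff (hX : IsAlphaCSF α X) (ht : 0 < t) :
    dt (cutoff X) t p = -2 * speed α X t p * normalPart X t p := by
  have h0 := (hX.smooth_coord 0).hasDerivAt_dt (p := p) ht
  have h1 := (hX.smooth_coord 1).hasDerivAt_dt (p := p) ht
  rw [(hX.dt_coord ht).1] at h0
  rw [(hX.dt_coord ht).2] at h1
  have h := ((h0.fun_mul h0).fun_add (h1.fun_mul h1)).const_sub (9 / 16)
  rw [dt, show (fun τ => cutoff X τ p) = _ from funext fun τ => cutoff_eq X τ p, h.deriv,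
    normalPart]
  ring

end IsAlphaCSF

/-! ### Compactness of the region of the maximum -/

namespace IsAlphaCSF

variable {α : ℝ} {X : ℝ → ℝ → Plane} {t p : ℝ}

theorem norm_velocity (hX : IsAlphaCSF α X) (ht : 0 < t) :
    ‖curvature (fun q => X q t) p ^ α • unitNormal (fun q => X q t) p‖ = speed α X t p := by
  have h1 : ‖unitNormal (fun q => X q t) p‖ = 1 := by
    have h2 : ‖unitNormal (fun q => X q t) p‖ ^ 2 = 1 := by
      rw [norm_sq_plane, ← (hX.frenet (p := p) ht).1]
      simp only [unitNormal, rotate, tangentCoord]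
      simp
      ring
    nlinarith [norm_nonneg (unitNormal (fun q => X q t) p)]
  rw [norm_smul, h1, mul_one]
  exact Real.norm_of_nonneg (hX.speed_pos ht.le).le

/-- While it is in the unit ball, where the speed is bounded, a point moves slowly. -/
theorem norm_le_of_norm_le_later (hX : IsAlphaCSF α X) {L : ℝ}
    (hL : ∀ p t, 0 ≤ t → X p t ∈ Metric.ball (0 : Plane) 1 → speed α X t p ≤ L) {b : ℝ}
    (hb : 0 < b) (hbt : b ≤ t) (hbt' : (t - b) * (|L| + 1) ≤ 1 / 8) (hp : ‖X p t‖ ≤ 3 / 4) :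
    ‖X p b‖ ≤ 7 / 8 := by
  have hL1 : 0 < |L| + 1 := by positivity
  have hder : ∀ s, s < t → HasDerivAt (fun s => X p (t - s))
      (-(curvature (fun q => X q (t - s)) p ^ α • unitNormal (fun q => X q (t - s)) p)) s := by
    intro s hs
    have h1 := hX.flow p (t - s) (by linarith)
    exact h1.comp_const_sub t s
  -- Time runs backwards. The comparison needs a strict inequality, hence slope |L| + 1, and only
  -- where the norm equals the barrier; there it is at most 7/8, so the speed bound applies.
  have key := image_norm_le_of_norm_deriv_right_lt_deriv_boundary (E := Plane)
    (f := fun s => X p (t - s)) (a := 0) (b := t - b)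
    (f' := fun s => -(curvature (fun q => X q (t - s)) p ^ α • unitNormal (fun q => X q (t - s)) p))
    (B := fun s => 3 / 4 + (|L| + 1) * s) (B' := fun _ => |L| + 1)
    (fun s hs => (hder s (by linarith [hs.2])).continuousAt.continuousWithinAt)
    (fun s hs => (hder s (by linarith [hs.2])).hasDerivWithinAt)
    (by simpa using hp)
    (fun s => by simpa using ((hasDerivAt_id s).const_mul (|L| + 1)).const_add (3 / 4))
    (fun s hs hs' => by
      have hpos : 0 < t - s := by linarith [hs.2]
      rw [norm_neg, hX.norm_velocity hpos]
      have h2 : (|L| + 1) * s ≤ 1 / 8 :=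
        le_trans (by nlinarith [hs.2]) hbt'
      have := hL p (t - s) hpos.le (by rw [mem_ball_zero_iff]; linarith)
      linarith [le_abs_self L])
    (x := t - b) ⟨by linarith, le_rfl⟩
  simp only [sub_sub_cancel] at key
  linarith

/-- Properness is known only slice by slice. On a short time interval, all points in the 3/4-ball
come from points in the 7/8-ball at the left end, and that one slice is proper; compactness of the
time interval does the rest. -/
theorem exists_bound_of_norm_le (hX : IsAlphaCSF α X) {L : ℝ}
    (hL : ∀ p t, 0 ≤ t → X p t ∈ Metric.ball (0 : Plane) 1 → speed α X t p ≤ L) {t₁ t₀ : ℝ}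
    (ht₁ : 0 < t₁) :
    ∃ R : ℝ, ∀ t ∈ Set.Icc t₁ t₀, ∀ p, ‖X p t‖ ≤ 3 / 4 → |p| ≤ R := by
  have hL1 : 0 < |L| + 1 := by positivity
  refine (isCompact_Icc (a := t₁) (b := t₀)).induction_on
    (p := fun S => ∃ R : ℝ, ∀ t ∈ S, ∀ p, ‖X p t‖ ≤ 3 / 4 → |p| ≤ R) ⟨0, by simp⟩ ?_ ?_ ?_
  · rintro S S' h ⟨R, hR⟩
    exact ⟨R, fun t ht => hR t (h ht)⟩
  · rintro S S' ⟨R, hR⟩ ⟨R', hR'⟩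
    refine ⟨max R R', fun t ht p hp => ?_⟩
    rcases ht with ht | ht
    · exact (hR t ht p hp).trans (le_max_left _ _)
    · exact (hR' t ht p hp).trans (le_max_right _ _)
  · intro t ht
    have htpos : 0 < t := ht₁.trans_le ht.1
    obtain ⟨r, hr0, hrt, hrL⟩ : ∃ r : ℝ, 0 < r ∧ r < t ∧ 2 * r * (|L| + 1) ≤ 1 / 8 := by
      refine ⟨min (t / 2) (1 / (16 * (|L| + 1))), by positivity,
        (min_le_left _ _).trans_lt (by linarith), ?_⟩
      have h1 := min_le_right (t / 2) (1 / (16 * (|L| + 1)))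
      rw [le_div_iff₀ (by positivity)] at h1
      linarith
    refine ⟨Set.Ioo (t - r) (t + r),
      mem_nhdsWithin_of_mem_nhds (Ioo_mem_nhds (by linarith) (by linarith)), ?_⟩
    have hcl := (hX.slice (t - r) (by linarith)).isClosedEmbedding
    have hc := hcl.isCompact_preimage (isCompact_closedBall (0 : Plane) (7 / 8))
    obtain ⟨R, hR⟩ := hc.isBounded.exists_norm_le
    refine ⟨R, fun s hs p hp => hR p ?_⟩
    have := hX.norm_le_of_norm_le_later hL (b := t - r) (t := s) (by linarith) hs.1.le
      (le_trans (mul_le_mul_of_nonneg_right (by linarith [hs.2]) hL1.le) hrL) hp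
    simpa using this

/-- The part of a solution in a small ball and in a compact interval of positive times is
parametrized by a compact set. -/
theorem isCompact_setOf_norm_le (hX : IsAlphaCSF α X) {L : ℝ}
    (hL : ∀ p t, 0 ≤ t → X p t ∈ Metric.ball (0 : Plane) 1 → speed α X t p ≤ L) {t₁ t₀ : ℝ}
    (ht₁ : 0 < t₁) :
    IsCompact {z : ℝ × ℝ | z.1 ∈ Set.Icc t₁ t₀ ∧ ‖X z.2 z.1‖ ≤ 3 / 4} := by
  obtain ⟨R, hR⟩ := hX.exists_bound_of_norm_le hL (t₀ := t₀) ht₁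
  have hK : IsCompact (Set.Icc t₁ t₀ ×ˢ Set.Icc (-R) R) := isCompact_Icc.prod isCompact_Icc
  have hcont : ContinuousOn (fun z : ℝ × ℝ => ‖X z.2 z.1‖) (Set.Icc t₁ t₀ ×ˢ Set.Icc (-R) R) :=
    (hX.continuousOn.comp (f := fun z : ℝ × ℝ => (z.2, z.1)) continuous_swap.continuousOn
      fun z hz => ⟨trivial, ht₁.le.trans hz.1.1⟩).norm
  have hclosed := hcont.preimage_isClosed_of_isClosed hK.isClosed
    (isClosed_Iic (a := (3 / 4 : ℝ)))
  convert hK.of_isClosed_subset hclosed Set.inter_subset_left using 1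
  ext z
  exact ⟨fun hz => ⟨⟨hz.1, abs_le.1 (hR _ hz.1 _ hz.2)⟩, hz.2⟩, fun hz => ⟨hz.1.1, hz.2⟩⟩

end IsAlphaCSF

/-! ### The algebra of Bernstein's estimate -/

-- When |W| dominates the other quantities, every term except -2lW² and 2R² is O(W²/M). The
-- first-order condition gives R = -lzW + O(W/M), and lB² = 1/4 gives 2l²z²W² ≤ lW²/2, so the
-- negative term wins for large M.
set_option maxHeartbeats 1000000 in
theorem exists_bernstein_constant (β γ k B P₀ H₀ U₀ S₀ : ℝ) (hB : 1 ≤ B) (hP₀ : 0 ≤ P₀)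
    (hH₀ : 0 ≤ H₀) (hU₀ : 0 ≤ U₀) (hS₀ : 0 ≤ S₀) :
    ∃ M : ℝ, 1 ≤ M ∧ ∀ z W q U R P H S : ℝ, |z| ≤ B → 0 ≤ q → 0 ≤ U → U ≤ U₀ →
      M ≤ |W| → M * q ≤ |W| → M * |P| ≤ P₀ * |W| → M * H ≤ H₀ * |W| → M * S ≤ S₀ * W ^ 2 →
      2 * R + 2 * P - 2 * γ * (z * q)
        + 1 / (4 * B ^ 2) * (2 * (z * W) - 2 * β * (z ^ 3 * q)) = 0 →
      4 * (1 - k) * (z * q * R) + 2 * (1 - k) * (W * q) - 2 * k * (1 - k) * (z ^ 2 * q ^ 2)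
        + 2 * (2 + 3 * k) * U + 2 * ((2 + 2 * k) * (1 + k)) * (U * z ^ 2 * q / W)
        + 2 * R ^ 2 + 2 * H + 2 * P ^ 2 + S - 2 * γ * (U + z ^ 2 * q ^ 2)
        + 1 / (4 * B ^ 2) * (-2 * W ^ 2 + 2 * (1 - k) * (z ^ 2 * W * q)
          + 2 * (2 + 2 * k) * (U * z ^ 2) - 2 * β * (U * z ^ 2)
          - 2 * β * (2 * β + 1) * (z ^ 4 * q ^ 2) + 8 * β * (z ^ 2 * W * q)) < 0 := by
  set l := 1 / (4 * B ^ 2) with hl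
  have hl0 : 0 < l := by positivity
  have hlB : l * B ^ 2 = 1 / 4 := by rw [hl]; field_simp
  have hB0 : 0 ≤ B := by linarith
  set Cρ := P₀ + |γ| * B + l * |β| * B ^ 3 with hCρ
  have hCρ0 : 0 ≤ Cρ := by positivity
  -- The sum of the coefficients of all error terms, each of which is bounded below by a multiple of
  -- E = W²/M; M is then chosen so that Ctot / M < l.
  set Ctot := 4 * |1 - k| * (B * (l * B + Cρ)) + 2 * |1 - k| + 2 * |k * (1 - k)| * B ^ 2
    + 2 * |2 + 3 * k| * U₀ + 2 * |(2 + 2 * k) * (1 + k)| * (U₀ * B ^ 2)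
    + (4 * l * B * Cρ + 2 * Cρ ^ 2) + 2 * H₀ + 2 * P₀ ^ 2 + S₀ + 2 * |γ| * (U₀ + B ^ 2)
    + l * (2 * |1 - k| * B ^ 2 + 2 * |2 + 2 * k| * (U₀ * B ^ 2) + 2 * |β| * (U₀ * B ^ 2)
      + 2 * |β * (2 * β + 1)| * B ^ 4 + 8 * |β| * B ^ 2) with hCtot
  have hCtot0 : 0 ≤ Ctot := by positivity
  refine ⟨Ctot / l + 1, by linarith [div_nonneg hCtot0 hl0.le], ?_⟩
  set M := Ctot / l + 1 with hM
  have hM1 : 1 ≤ M := by linarith [div_nonneg hCtot0 hl0.le]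
  intro z W q U R P H S hz hq hU hUU₀ hW1 hWq hWP hWH hWS hR
  have hM0 : 0 < M := by linarith
  obtain ⟨δ, hδ⟩ : ∃ δ, δ = M⁻¹ := ⟨_, rfl⟩
  have hδ0 : 0 < δ := by rw [hδ]; positivity
  have hδ1 : δ ≤ 1 := by rw [hδ]; exact inv_le_one_of_one_le₀ hM1
  have hδM : δ * M = 1 := by rw [hδ]; exact inv_mul_cancel₀ hM0.ne'
  have hδC : δ * Ctot < l := by
    have : Ctot < l * M := by rw [hM, mul_add, mul_div_cancel₀ _ hl0.ne']; linarith
    calc δ * Ctot < δ * (l * M) := by gcongr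
      _ = l := by linear_combination l * hδM
  have scale : ∀ {a b : ℝ}, M * a ≤ b → a ≤ δ * b := fun {a b} h => by
    calc a = δ * (M * a) := by linear_combination -a * hδM
      _ ≤ δ * b := by gcongr
  obtain ⟨y, hy⟩ : ∃ y, y = |W| := ⟨_, rfl⟩
  have hy2 : W ^ 2 = y ^ 2 := by rw [hy, sq_abs]
  rw [← hy] at hW1 hWq hWP hWH
  have hy1 : 1 ≤ y := hM1.trans hW1
  have hy0 : 0 < y := by linarith
  have h1y : 1 ≤ δ * y := scale (by linarith)
  have hqy : q ≤ δ * y := scale hWq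
  have hPy : |P| ≤ P₀ * (δ * y) := by have := scale hWP; linarith
  have hHy : H ≤ H₀ * (δ * y) := by have := scale hWH; linarith
  have hSy : S ≤ S₀ * (δ * y ^ 2) := by have := scale hWS; rw [hy2] at this; linarith
  obtain ⟨E, hE⟩ : ∃ E, E = δ * y ^ 2 := ⟨_, rfl⟩
  have hyE : δ * y ≤ E := by rw [hE]; gcongr; exact le_self_pow₀ hy1 two_ne_zero
  have h1E : 1 ≤ E := h1y.trans hyE
  have hyyE : (δ * y) * (δ * y) ≤ E := by
    calc (δ * y) * (δ * y) = δ * (δ * y ^ 2) := by ring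
      _ ≤ 1 * (δ * y ^ 2) := by gcongr
      _ = E := by rw [hE, one_mul]
  have hyyE' : y * (δ * y) = E := by rw [hE]; ring
  have hE0 : 0 ≤ E := by linarith
  -- The part of R = w_s/w that is small compared with W.
  obtain ⟨ρ, hρ⟩ : ∃ ρ, ρ = -P + γ * (z * q) + l * β * (z ^ 3 * q) := ⟨_, rfl⟩
  have hRρ : R = -(l * (z * W)) + ρ := by rw [hρ]; linear_combination (1 / 2) * hR
  have hqabs : |q| ≤ δ * y := by rwa [abs_of_nonneg hq]
  have hUabs : |U| ≤ U₀ := by rwa [abs_of_nonneg hU]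
  have hρy : |ρ| ≤ Cρ * (δ * y) := by
    calc |ρ| ≤ |P| + |γ| * (|z| * |q|) + l * |β| * (|z| ^ 3 * |q|) := by
          rw [hρ]
          refine (abs_add_le _ _).trans (add_le_add ((abs_add_le _ _).trans (add_le_add ?_ ?_)) ?_)
          · rw [abs_neg]
          · rw [abs_mul, abs_mul]
          · rw [abs_mul, abs_mul, abs_mul, abs_pow, abs_of_pos hl0]
      _ ≤ P₀ * (δ * y) + |γ| * (B * (δ * y)) + l * |β| * (B ^ 3 * (δ * y)) := by gcongr
      _ = Cρ * (δ * y) := by rw [hCρ]; ring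
  have hRy : |R| ≤ (l * B + Cρ) * y := by
    calc |R| ≤ l * (|z| * |W|) + |ρ| := by
          rw [hRρ]
          refine (abs_add_le _ _).trans (add_le_add ?_ le_rfl)
          rw [abs_neg, abs_mul, abs_mul, abs_of_pos hl0]
      _ ≤ l * (B * y) + Cρ * (1 * y) := by rw [← hy]; gcongr; exact hρy.trans (by gcongr)
      _ = _ := by ring
  have bound : ∀ {c x D : ℝ}, |x| ≤ D * E → c * x ≤ |c| * D * E := fun {c x D} h => by
    calc c * x ≤ |c * x| := le_abs_self _
      _ = |c| * |x| := abs_mul _ _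
      _ ≤ |c| * (D * E) := by gcongr
      _ = _ := by ring
  have b1 : |z * q * R| ≤ (B * (l * B + Cρ)) * E := by
    rw [abs_mul, abs_mul]
    calc |z| * |q| * |R| ≤ B * (δ * y) * ((l * B + Cρ) * y) := by gcongr
      _ = _ := by rw [hE]; ring
  have b2 : |W * q| ≤ 1 * E := by
    rw [abs_mul, ← hy, one_mul, ← hyyE']; gcongr
  have b3 : |z ^ 2 * q ^ 2| ≤ B ^ 2 * E := by
    rw [abs_mul, abs_pow, abs_pow]
    calc |z| ^ 2 * |q| ^ 2 ≤ B ^ 2 * (δ * y) ^ 2 := by gcongr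
      _ ≤ B ^ 2 * E := by rw [sq (δ * y)]; gcongr
  have b4 : |U| ≤ U₀ * E := hUabs.trans (le_mul_of_one_le_right hU₀ h1E)
  have b5 : |U * z ^ 2 * q / W| ≤ (U₀ * B ^ 2) * E := by
    rw [abs_div, abs_mul, abs_mul, abs_pow, ← hy, div_le_iff₀ hy0]
    calc |U| * |z| ^ 2 * |q| ≤ U₀ * B ^ 2 * (δ * y) := by gcongr
      _ ≤ U₀ * B ^ 2 * (E * y) := 
          mul_le_mul_of_nonneg_left (hyE.trans (le_mul_of_one_le_right hE0 hy1)) (by positivity)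
      _ = _ := by ring
  have b6 : 2 * R ^ 2 ≤ l / 2 * y ^ 2 + (4 * l * B * Cρ + 2 * Cρ ^ 2) * E := by
    have e1 : 2 * R ^ 2 = 2 * l ^ 2 * (|z| ^ 2 * |W| ^ 2) + (-4 * l) * (z * W * ρ) + 2 * |ρ| ^ 2 := by
      rw [hRρ, sq_abs, sq_abs, sq_abs]; ring
    have e2 : 2 * l ^ 2 * (|z| ^ 2 * |W| ^ 2) ≤ l / 2 * y ^ 2 := by
      calc 2 * l ^ 2 * (|z| ^ 2 * |W| ^ 2) ≤ 2 * l ^ 2 * (B ^ 2 * y ^ 2) := by rw [hy]; gcongr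
        _ = l / 2 * y ^ 2 := by linear_combination 2 * l * y ^ 2 * hlB
    have e3 : (-4 * l) * (z * W * ρ) ≤ |-4 * l| * (B * Cρ) * E := bound (by
      rw [abs_mul, abs_mul, ← hy]
      calc |z| * y * |ρ| ≤ B * y * (Cρ * (δ * y)) := by gcongr
        _ = _ := by rw [hE]; ring)
    have e4 : 2 * |ρ| ^ 2 ≤ 2 * Cρ ^ 2 * E := by
      calc 2 * |ρ| ^ 2 ≤ 2 * (Cρ * (δ * y)) ^ 2 := by gcongr
        _ = 2 * Cρ ^ 2 * ((δ * y) * (δ * y)) := by ring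
        _ ≤ _ := by gcongr
    rw [abs_mul, abs_of_pos hl0, abs_neg, abs_of_pos (by norm_num : (0 : ℝ) < 4)] at e3
    linarith
  have b7 : 2 * H ≤ 2 * H₀ * E := by linarith [mul_le_mul_of_nonneg_left hyE hH₀]
  have b8 : 2 * P ^ 2 ≤ 2 * P₀ ^ 2 * E := by
    rw [← sq_abs]
    calc 2 * |P| ^ 2 ≤ 2 * (P₀ * (δ * y)) ^ 2 := by gcongr
      _ = 2 * P₀ ^ 2 * ((δ * y) * (δ * y)) := by ring
      _ ≤ _ := by gcongr
  have b9 : S ≤ S₀ * E := by rw [hE]; exact hSy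
  have b10 : |U + z ^ 2 * q ^ 2| ≤ (U₀ + B ^ 2) * E := by
    refine (abs_add_le _ _).trans ?_; linarith
  have b11 : |z ^ 2 * W * q| ≤ B ^ 2 * E := by
    rw [mul_assoc, abs_mul, abs_pow]
    rw [one_mul] at b2
    gcongr
  have b12 : |U * z ^ 2| ≤ (U₀ * B ^ 2) * E := by
    rw [abs_mul, abs_pow]
    calc |U| * |z| ^ 2 ≤ U₀ * B ^ 2 * 1 := by rw [mul_one]; gcongr
      _ ≤ _ := by gcongr
  have b13 : |z ^ 4 * q ^ 2| ≤ B ^ 4 * E := by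
    rw [abs_mul, abs_pow, abs_pow]
    calc |z| ^ 4 * |q| ^ 2 ≤ B ^ 4 * (δ * y) ^ 2 := by gcongr
      _ ≤ B ^ 4 * E := by rw [sq (δ * y)]; gcongr
  have c1 := bound (c := 1 - k) b1
  have c2 := bound (c := 1 - k) b2
  have c3 := bound (c := -(k * (1 - k))) b3
  have c4 := bound (c := 2 + 3 * k) b4
  have c5 := bound (c := (2 + 2 * k) * (1 + k)) b5
  have c10 := bound (c := -γ) b10
  have c11 := bound (c := 1 - k) b11
  have c12 := bound (c := 2 + 2 * k) b12
  have c13 := bound (c := -β) b12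
  have c14 := bound (c := -(β * (2 * β + 1))) b13
  have c15 := bound (c := β) b11
  rw [abs_neg] at c3 c10 c13 c14
  have d := mul_le_mul_of_nonneg_left (show
      -2 * W ^ 2 + 2 * (1 - k) * (z ^ 2 * W * q)
          + 2 * (2 + 2 * k) * (U * z ^ 2) - 2 * β * (U * z ^ 2)
          - 2 * β * (2 * β + 1) * (z ^ 4 * q ^ 2) + 8 * β * (z ^ 2 * W * q) ≤ -2 * y ^ 2 +
      (2 * |1 - k| * B ^ 2 + 2 * |2 + 2 * k| * (U₀ * B ^ 2) + 2 * |β| * (U₀ * B ^ 2)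
      + 2 * |β * (2 * β + 1)| * B ^ 4 + 8 * |β| * B ^ 2) * E by rw [hy2]; linarith) hl0.le
  have hfin : Ctot * E < l * y ^ 2 := by
    rw [hE, ← mul_assoc, mul_comm Ctot]; gcongr
  have hly : 0 < l * y ^ 2 := by positivity
  rw [hCtot] at hfin
  linarith

/-! ### The maximum principle for the auxiliary function -/

/-- The logarithm of Bernstein's auxiliary function
`η² (t - t₁) u_ss² u ^ (-2 γ) exp (l u_s² u ^ (-2 β))`. -/
noncomputable def logBernstein (α β γ l t₁ : ℝ) (X : ℝ → ℝ → Plane) (t p : ℝ) : ℝ :=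
  2 * Real.log (speedSS α X t p) + 2 * Real.log (cutoff X t p) + Real.log (t - t₁)
    - 2 * γ * Real.log (speed α X t p) + l * (speedS α X t p ^ 2 * speed α X t p ^ (-2 * β))

/-- The right side is (∂_t - aA ∂_s²) log F with the evolution equations inserted; here u, v, w, w₁,
w₂ are the speed and its successive s-derivatives, b = u^β, and e, m are the tangential and normal
parts of X. The left side is the same in the scaled quantities z = v/b, W = w/b, q = b/u. -/
theorem bernstein_identity {a b A u v w w₁ w₂ e m κ η T β γ l : ℝ} (ha : a ≠ 0) (hb : b ≠ 0)
    (hA : A ≠ 0) (hu : u ≠ 0) (hw : w ≠ 0) (hη : η ≠ 0) (hT : T ≠ 0) (U : ℝ) (hκ : κ * A = u) :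
    a * A * (4 * (1 - 1 / a) * (v / b * (b / u) * (w₁ / w)) + 2 * (1 - 1 / a) * (w / b * (b / u))
        - 2 * (1 / a) * (1 - 1 / a) * ((v / b) ^ 2 * (b / u) ^ 2)
        + 2 * (2 + 3 * (1 / a)) * U
        + 2 * ((2 + 2 * (1 / a)) * (1 + 1 / a)) * (U * (v / b) ^ 2 * (b / u) / (w / b))
        + 2 * (w₁ / w) ^ 2 + 2 * ((2 * (1 + κ * m) - 2 * κ * m / a) / η) + 2 * (-2 * e / η) ^ 2
        + 1 / (a * A * T) - 2 * γ * (U + (v / b) ^ 2 * (b / u) ^ 2)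
        + l * (-2 * (w / b) ^ 2 + 2 * (1 - 1 / a) * ((v / b) ^ 2 * (w / b) * (b / u))
          + 2 * (2 + 2 * (1 / a)) * (U * (v / b) ^ 2) - 2 * β * (U * (v / b) ^ 2)
          - 2 * β * (2 * β + 1) * ((v / b) ^ 4 * (b / u) ^ 2)
          + 8 * β * ((v / b) ^ 2 * (w / b) * (b / u)))) =
    2 * (a * A * (w₂ + 2 * (1 - 1 / a) * (v * w₁ / u) + (1 - 1 / a) * (w ^ 2 / u)
        - 1 / a * (1 - 1 / a) * (v ^ 2 * w / u ^ 2) + (2 + 3 * (1 / a)) * (U * w)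
        + (2 + 2 * (1 / a)) * (1 + 1 / a) * (U * v ^ 2 / u)) / w)
      + 2 * (-2 * u * m / η) + 1 / T - 2 * γ * (a * A * (w + U * u) / u)
      + l * (2 * v * (a * A * (w₁ + (1 - 1 / a) * (v * w / u) + (2 + 2 * (1 / a)) * (U * v)))
          * (1 / b ^ 2) + v ^ 2 * (-2 * β * (1 / b ^ 2 / u) * (a * A * (w + U * u))))
      - a * A * (2 * ((w₂ * w - w₁ * w₁) / w ^ 2)
        + 2 * ((-2 * (1 + κ * m) * η - -2 * e * (-2 * e)) / η ^ 2)
        - 2 * γ * ((w * u - v * v) / u ^ 2)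
        + l * (2 * (w * w + v * w₁) * (1 / b ^ 2) + 2 * (v * w) * (-2 * β * (1 / b ^ 2 / u) * v)
          + -2 * β * ((3 * v ^ 2 * w * (1 / b ^ 2) + v ^ 3 * (-2 * β * (1 / b ^ 2 / u) * v)) / u
            - v ^ 3 * (1 / b ^ 2) * v / u ^ 2))) := by
  subst hκ
  have hκ0 : κ ≠ 0 := left_ne_zero_of_mul hu
  field_simp
  ring

namespace IsAlphaCSF

variable {α : ℝ} {X : ℝ → ℝ → Plane} {t p : ℝ}

theorem hasDerivAt_logBernstein (hX : IsAlphaCSF α X) (ht : 0 < t) (β γ l t₁ : ℝ)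
    (hw : speedSS α X t p ≠ 0) (hη : cutoff X t p ≠ 0) :
    HasDerivAt (logBernstein α β γ l t₁ X t) (lengthElement X t p *
      (2 * (ds X (speedSS α X) t p / speedSS α X t p)
        + 2 * (-2 * tangentialPart X t p / cutoff X t p)
        - 2 * γ * (speedS α X t p / speed α X t p)
        + l * (2 * (speedS α X t p * speedSS α X t p) * speed α X t p ^ (-2 * β)
          + -2 * β * (speedS α X t p ^ 3 * speed α X t p ^ (-2 * β) / speed α X t p)))) p := by
  have hpos := hX.speed_pos (p := p) ht.le
  have hu : HasDerivAt (speed α X t) (lengthElement X t p * speedS α X t p) p :=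
    hX.hasDerivAt_ds ht hX.smooth_speed
  have hv : HasDerivAt (speedS α X t) (lengthElement X t p * speedSS α X t p) p :=
    hX.hasDerivAt_ds ht hX.smooth_speedS
  have h := ((((((hX.hasDerivAt_ds (p := p) ht hX.smooth_speedSS).log hw).const_mul 2).fun_add
    (((hX.hasDerivAt_cutoff (p := p) ht).log hη).const_mul 2)).add_const
    (Real.log (t - t₁))).fun_sub ((hu.log hpos.ne').const_mul (2 * γ))).fun_add
    (((hv.fun_pow 2).fun_mul (hu.rpow_const_div hpos (-2 * β))).const_mul l)
  refine h.congr_deriv ?_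
  generalize speed α X t p ^ (-2 * β) = φ
  push_cast
  field_simp

/-- The conclusions are (log F)_s = 0 and (∂_t - αA ∂_s²) log F ≥ 0, the latter divided by αA > 0.
Only earlier times are compared, since the maximum may occur at the final time. -/
theorem bernstein_at_max (hX : IsAlphaCSF α X) (hα : 0 < α) (β γ l : ℝ) {t₁ : ℝ} (ht₁ : 0 < t₁)
    (ht : t₁ < t) (hw : speedSS α X t p ≠ 0) (hη : 0 < cutoff X t p)
    (hmax : IsLocalMax (logBernstein α β γ l t₁ X t) p)
    (hleft : ∀ᶠ τ in nhdsWithin t (Set.Iio t),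
      logBernstein α β γ l t₁ X τ p ≤ logBernstein α β γ l t₁ X t p)
    {z W q U R P H S : ℝ} (hz : z = speedS α X t p / speed α X t p ^ β)
    (hW : W = speedSS α X t p / speed α X t p ^ β) (hq : q = speed α X t p ^ β / speed α X t p)
    (hU : U = speed α X t p ^ (2 * (1 / α))) (hR : R = ds X (speedSS α X) t p / speedSS α X t p)
    (hP : P = -2 * tangentialPart X t p / cutoff X t p)
    (hH : H = (2 * (1 + curv X t p * normalPart X t p)
      - 2 * curv X t p * normalPart X t p / α) / cutoff X t p)
    (hS : S = 1 / (α * speed α X t p ^ (1 - 1 / α) * (t - t₁))) :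
    2 * R + 2 * P - 2 * γ * (z * q) + l * (2 * (z * W) - 2 * β * (z ^ 3 * q)) = 0 ∧
    0 ≤ 4 * (1 - 1 / α) * (z * q * R) + 2 * (1 - 1 / α) * (W * q)
        - 2 * (1 / α) * (1 - 1 / α) * (z ^ 2 * q ^ 2)
        + 2 * (2 + 3 * (1 / α)) * U
        + 2 * ((2 + 2 * (1 / α)) * (1 + 1 / α)) * (U * z ^ 2 * q / W)
        + 2 * R ^ 2 + 2 * H + 2 * P ^ 2 + S - 2 * γ * (U + z ^ 2 * q ^ 2)
        + l * (-2 * W ^ 2 + 2 * (1 - 1 / α) * (z ^ 2 * W * q)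
          + 2 * (2 + 2 * (1 / α)) * (U * z ^ 2) - 2 * β * (U * z ^ 2)
          - 2 * β * (2 * β + 1) * (z ^ 4 * q ^ 2) + 8 * β * (z ^ 2 * W * q)) := by
  have htpos : 0 < t := ht₁.trans ht
  have hpos := hX.speed_pos (p := p) htpos.le
  have hu : HasDerivAt (speed α X t) (lengthElement X t p * speedS α X t p) p :=
    hX.hasDerivAt_ds htpos hX.smooth_speed
  have hv : HasDerivAt (speedS α X t) (lengthElement X t p * speedSS α X t p) p :=
    hX.hasDerivAt_ds htpos hX.smooth_speedS
  have hwd := hX.hasDerivAt_ds (p := p) htpos hX.smooth_speedSS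
  have hw1d := hX.hasDerivAt_ds (p := p) htpos (hX.smooth_ds hX.smooth_speedSS)
  have hηd := hX.hasDerivAt_cutoff (p := p) htpos
  have hed := hX.hasDerivAt_tangentialPart (p := p) htpos
  have hφd := hu.rpow_const_div hpos (-2 * β)
  have hg0 := hX.lengthElement_pos (p := p) htpos.le
  have hφ : speed α X t p ^ (-2 * β) = 1 / (speed α X t p ^ β) ^ 2 := by
    rw [neg_mul, Real.rpow_neg hpos.le, mul_comm, Real.rpow_mul hpos.le, Real.rpow_two, one_div]
  have hD1 : ∀ᶠ q in nhds p, HasDerivAt (logBernstein α β γ l t₁ X t) (lengthElement X t q *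
      (fun p => 2 * (ds X (speedSS α X) t p / speedSS α X t p)
        + 2 * (-2 * tangentialPart X t p / cutoff X t p)
        - 2 * γ * (speedS α X t p / speed α X t p)
        + l * (2 * (speedS α X t p * speedSS α X t p) * speed α X t p ^ (-2 * β)
          + -2 * β * (speedS α X t p ^ 3 * speed α X t p ^ (-2 * β) / speed α X t p))) q) q := by
    filter_upwards [hwd.continuousAt.eventually_ne hw, hηd.continuousAt.eventually_ne hη.ne']
      with q h1 h2 using hX.hasDerivAt_logBernstein htpos β γ l t₁ h1 h2
  have hD2 := ((((hw1d.fun_div hwd hw).const_mul 2).fun_add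
    (((hed.const_mul (-2)).fun_div hηd hη.ne').const_mul 2)).fun_sub
    ((hv.fun_div hu hpos.ne').const_mul (2 * γ))).fun_add
    (((((hv.fun_mul hwd).const_mul 2).fun_mul hφd).fun_add
      ((((hv.fun_pow 3).fun_mul hφd).fun_div hu hpos.ne').const_mul (-2 * β))).const_mul l)
  obtain ⟨h1, h2⟩ := hmax.arcLength_second_deriv_nonpos hg0
    (hX.smooth_lengthElement.hasDerivAt_dp htpos) hD1 (hD2.congr_deriv (g' := lengthElement X t p *
      (2 * ((ds X (ds X (speedSS α X)) t p * speedSS α X t p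
          - ds X (speedSS α X) t p * ds X (speedSS α X) t p) / speedSS α X t p ^ 2)
        + 2 * ((-2 * (1 + curv X t p * normalPart X t p) * cutoff X t p
          - -2 * tangentialPart X t p * (-2 * tangentialPart X t p)) / cutoff X t p ^ 2)
        - 2 * γ * ((speedSS α X t p * speed α X t p - speedS α X t p * speedS α X t p)
          / speed α X t p ^ 2)
        + l * (2 * (speedSS α X t p * speedSS α X t p + speedS α X t p * ds X (speedSS α X) t p)
            * (speed α X t p ^ (-2 * β))
          + 2 * (speedS α X t p * speedSS α X t p)
            * (-2 * β * (speed α X t p ^ (-2 * β) / speed α X t p) * speedS α X t p)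
          + -2 * β * ((3 * speedS α X t p ^ 2 * speedSS α X t p * (speed α X t p ^ (-2 * β))
            + speedS α X t p ^ 3
              * (-2 * β * (speed α X t p ^ (-2 * β) / speed α X t p) * speedS α X t p))
                / speed α X t p
            - speedS α X t p ^ 3 * (speed α X t p ^ (-2 * β)) * speedS α X t p
              / speed α X t p ^ 2)))) (by
      generalize speed α X t p ^ (-2 * β) = φ
      push_cast
      field_simp))
  have hT : 0 < t - t₁ := sub_pos.2 ht
  have hGt := ((((hX.smooth_speedSS.hasDerivAt_dt (p := p) htpos).log hw).const_mul 2).fun_add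
    (((hX.smooth_cutoff.hasDerivAt_dt (p := p) htpos).log hη.ne').const_mul 2)).fun_add
    (((hasDerivAt_id t).sub_const t₁).log hT.ne')
  have hut := hX.smooth_speed.hasDerivAt_dt (p := p) htpos
  have hGt := (hGt.fun_sub ((hut.log hpos.ne').const_mul (2 * γ))).fun_add
    ((((hX.smooth_speedS.hasDerivAt_dt (p := p) htpos).fun_pow 2).fun_mul
      (hut.rpow_const_div hpos (-2 * β))).const_mul l)
  have h3 := hGt.nonneg_of_eventually_le_left hleft
  rw [hX.dt_speed hα htpos, hX.dt_speedS hα htpos, hX.dt_speedSS hα htpos, hX.dt_cutoff htpos] at h3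
  have hb : 0 < speed α X t p ^ β := Real.rpow_pos_of_pos hpos _
  have hA : 0 < speed α X t p ^ (1 - 1 / α) := Real.rpow_pos_of_pos hpos _
  have hκ := hX.curv_mul_rpow (p := p) hα htpos.le
  rw [hφ] at h2 h3
  simp only [hφ] at h1
  subst hz hW hq hU hR hP hH hS
  constructor
  · rw [← h1]
    generalize speed α X t p ^ β = b at *
    field_simp
    ring
  · refine nonneg_of_mul_nonneg_right (a := α * speed α X t p ^ (1 - 1 / α)) ?_ (by positivity)
    rw [bernstein_identity (w₂ := ds X (ds X (speedSS α X)) t p) hα.ne' hb.ne' hA.ne' hpos.ne' hw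
      hη.ne' hT.ne' _ hκ]
    refine sub_nonneg.2 (le_trans (mul_nonpos_of_nonneg_of_nonpos (by positivity) h2) ?_)
    simpa using h3

end IsAlphaCSF

/-! ### The interior estimate -/

/-- Bernstein's auxiliary function. -/
noncomputable def bernsteinFn (α β γ l t₁ : ℝ) (X : ℝ → ℝ → Plane) (t p : ℝ) : ℝ :=
  cutoff X t p ^ 2 * (t - t₁) * (speedSS α X t p ^ 2 * speed α X t p ^ (-2 * γ)) *
    Real.exp (l * (speedS α X t p ^ 2 * speed α X t p ^ (-2 * β)))

theorem norm_le_of_cutoff_nonneg {X : ℝ → ℝ → Plane} {t p : ℝ} (h : 0 ≤ cutoff X t p) :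
    ‖X p t‖ ≤ 3 / 4 := by
  rw [cutoff] at h
  nlinarith [norm_nonneg (X p t)]

theorem cutoff_nonneg {X : ℝ → ℝ → Plane} {t p : ℝ} (h : ‖X p t‖ ≤ 3 / 4) :
    0 ≤ cutoff X t p := by
  rw [cutoff]
  nlinarith [norm_nonneg (X p t)]

theorem cutoff_le_one (X : ℝ → ℝ → Plane) (t p : ℝ) : cutoff X t p ≤ 1 := by
  rw [cutoff]
  nlinarith [norm_nonneg (X p t)]

namespace IsAlphaCSF

variable {α : ℝ} {X : ℝ → ℝ → Plane} {t p : ℝ}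

/-- The sign of u_ss plays no role, because `Real.log` is even. -/
theorem log_bernsteinFn (hX : IsAlphaCSF α X) (β γ l : ℝ) {t₁ : ℝ} (ht₁ : 0 < t₁) (ht : t₁ < t)
    (hw : speedSS α X t p ≠ 0) (hη : 0 < cutoff X t p) :
    0 < bernsteinFn α β γ l t₁ X t p ∧
    logBernstein α β γ l t₁ X t p = Real.log (bernsteinFn α β γ l t₁ X t p) := by
  have hpos := hX.speed_pos (p := p) (ht₁.trans ht).le
  have hu : 0 < speed α X t p ^ (-2 * γ) := Real.rpow_pos_of_pos hpos _
  have hT : 0 < t - t₁ := sub_pos.2 ht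
  have hw2 : 0 < speedSS α X t p ^ 2 := by positivity
  refine ⟨by unfold bernsteinFn; positivity, ?_⟩
  rw [bernsteinFn, logBernstein, Real.log_mul (by positivity) (by positivity),
    Real.log_mul (by positivity) (by positivity), Real.log_mul (by positivity) (by positivity),
    Real.log_mul (by positivity) (by positivity), Real.log_exp, Real.log_rpow hpos, Real.log_pow,
    Real.log_pow]
  push_cast
  ring

theorem continuousOn_bernsteinFn (hX : IsAlphaCSF α X) (β γ l t₁ : ℝ) :
    ContinuousOn (fun z : ℝ × ℝ => bernsteinFn α β γ l t₁ X z.1 z.2) (Set.Ioi 0 ×ˢ Set.univ) := by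
  have h0 : ContinuousOn (fun z : ℝ × ℝ => cutoff X z.1 z.2) (Set.Ioi 0 ×ˢ Set.univ) :=
    hX.smooth_cutoff.continuousOn
  have h1 : ContinuousOn (fun z : ℝ × ℝ => speedSS α X z.1 z.2) (Set.Ioi 0 ×ˢ Set.univ) :=
    hX.smooth_speedSS.continuousOn
  have h2 : ContinuousOn (fun z : ℝ × ℝ => speedS α X z.1 z.2) (Set.Ioi 0 ×ˢ Set.univ) :=
    hX.smooth_speedS.continuousOn
  have h3 : ∀ a : ℝ, ContinuousOn (fun z : ℝ × ℝ => speed α X z.1 z.2 ^ a)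
      (Set.Ioi 0 ×ˢ Set.univ) := fun a =>
    (hX.smooth_speed.rpow (fun _ _ ht => (hX.speed_pos ht.le).ne') a).continuousOn
  exact (((h0.pow 2).mul (continuousOn_fst.sub continuousOn_const)).mul ((h1.pow 2).mul
    (h3 _))).mul (((h2.pow 2).mul (h3 _)).const_smul l).rexp

/-- At a positive maximum, one of three inequalities holds. -/
theorem exists_bernstein_alternative {β γ B L₀ : ℝ} (hα : 0 < α) (hB : 1 ≤ B)
    (hL₀ : 1 ≤ L₀) :
    ∃ M : ℝ, 1 ≤ M ∧ ∀ X : ℝ → ℝ → Plane, IsAlphaCSF α X → ∀ t₁ t p : ℝ, 0 < t₁ → t₁ < t →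
      speedSS α X t p ≠ 0 → 0 < cutoff X t p → speed α X t p ≤ L₀ →
      |speedS α X t p| ≤ B * speed α X t p ^ β →
      IsLocalMax (logBernstein α β γ (1 / (4 * B ^ 2)) t₁ X t) p →
      (∀ᶠ τ in nhdsWithin t (Set.Iio t),
        logBernstein α β γ (1 / (4 * B ^ 2)) t₁ X τ p
          ≤ logBernstein α β γ (1 / (4 * B ^ 2)) t₁ X t p) →
      |speedSS α X t p / speed α X t p ^ β| ≤ M * (speed α X t p ^ β / speed α X t p) ∨
      cutoff X t p * |speedSS α X t p / speed α X t p ^ β| ≤ M ∨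
      (t - t₁) * speed α X t p ^ (1 - 1 / α) * (speedSS α X t p / speed α X t p ^ β) ^ 2 ≤ M := by
  have hk : 0 < 1 / α := by positivity
  have hL₀' : 0 < L₀ := by linarith
  -- The bounds 2 and 2 + 2L₀^(1/α) + 2L₀^(1/α)/α are those of η|P| and ηH, where |X| ≤ 1 and κ ≤
  -- L₀^(1/α); L₀^(2/α) bounds U = κ².
  obtain ⟨M, hM1, hM⟩ := exists_bernstein_constant β γ (1 / α) B 2
    (2 + 2 * L₀ ^ (1 / α) + 2 * L₀ ^ (1 / α) / α) (L₀ ^ (2 * (1 / α))) (1 / α) hB (by norm_num)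
    (by positivity) (by positivity) hk.le
  refine ⟨M, hM1, fun X hX t₁ t p ht₁ ht hw hη hL hv hmax hleft => ?_⟩
  by_contra! hcon
  obtain ⟨ha, hb, hc⟩ := hcon
  have htpos := ht₁.trans ht
  have hT : 0 < t - t₁ := sub_pos.2 ht
  have hpos := hX.speed_pos (p := p) htpos.le
  have hbpos : 0 < speed α X t p ^ β := Real.rpow_pos_of_pos hpos _
  have hA : 0 < speed α X t p ^ (1 - 1 / α) := Real.rpow_pos_of_pos hpos _
  obtain ⟨h1, h2⟩ := hX.bernstein_at_max hα β γ (1 / (4 * B ^ 2)) ht₁ ht hw hη hmax hleft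
    rfl rfl rfl rfl rfl rfl rfl rfl
  have hX1 : ‖X p t‖ ≤ 1 := (norm_le_of_cutoff_nonneg hη.le).trans (by norm_num)
  have hX2 : ‖X p t‖ ^ 2 ≤ 1 := pow_le_one₀ (norm_nonneg _) hX1
  have hsq := hX.tangentialPart_sq_add (p := p) htpos
  have he : |tangentialPart X t p| ≤ 1 := (sq_le_one_iff_abs_le_one _).1 (by
    linarith [sq_nonneg (normalPart X t p)])
  have hm : |normalPart X t p| ≤ 1 := (sq_le_one_iff_abs_le_one _).1 (by
    linarith [sq_nonneg (tangentialPart X t p)])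
  have hκ0 := hX.curv_pos (p := p) htpos.le
  have hκ : curv X t p ≤ L₀ ^ (1 / α) := by
    rw [hX.curv_eq hα htpos.le]
    exact Real.rpow_le_rpow hpos.le hL hk.le
  have hκm : |curv X t p * normalPart X t p| ≤ L₀ ^ (1 / α) := by
    rw [abs_mul, abs_of_pos hκ0]
    exact (mul_le_of_le_one_right hκ0.le hm).trans hκ
  have hWpos : 0 ≤ |speedSS α X t p / speed α X t p ^ β| := abs_nonneg _
  refine absurd h2 (not_le.2 (hM _ _ _ _ _ _ _ _ ?_ (by positivity) (by positivity) ?_ ?_ ha.le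
    ?_ ?_ ?_ h1))
  · rwa [abs_div, abs_of_pos hbpos, div_le_iff₀ hbpos]
  · exact Real.rpow_le_rpow hpos.le hL (by positivity)
  · exact hb.le.trans (mul_le_of_le_one_left hWpos (cutoff_le_one X t p))
  · rw [abs_div, abs_of_pos hη, abs_mul, abs_neg, abs_two, mul_div_assoc', div_le_iff₀ hη]
    linarith [mul_le_of_le_one_right (show 0 ≤ M by linarith) he]
  · rw [mul_div_assoc', div_le_iff₀ hη]
    have h3 : 2 * (1 + curv X t p * normalPart X t p) - 2 * curv X t p * normalPart X t p / α
        ≤ 2 + 2 * L₀ ^ (1 / α) + 2 * L₀ ^ (1 / α) / α := by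
      have h4 : -(2 * curv X t p * normalPart X t p / α) ≤ 2 * L₀ ^ (1 / α) / α := by
        rw [← neg_div]
        gcongr
        linarith [(abs_le.1 hκm).1]
      linarith [(abs_le.1 hκm).2]
    have h5 : 0 ≤ 2 + 2 * L₀ ^ (1 / α) + 2 * L₀ ^ (1 / α) / α := by positivity
    calc M * _ ≤ M * (2 + 2 * L₀ ^ (1 / α) + 2 * L₀ ^ (1 / α) / α) := by gcongr
      _ ≤ (cutoff X t p * |speedSS α X t p / speed α X t p ^ β|) *
          (2 + 2 * L₀ ^ (1 / α) + 2 * L₀ ^ (1 / α) / α) := by gcongr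
      _ = _ := by ring
  · rw [mul_one_div, div_le_iff₀ (by positivity)]
    refine hc.le.trans (le_of_eq ?_)
    field_simp

/-- The interior estimate for the second derivative of the speed. -/
theorem exists_bernstein_bound {β : ℝ} (hα : 0 < α) (hβ : β < 1 / α) (K L : ℝ) :
    ∃ l C : ℝ, 0 < l ∧ 0 < C ∧ ∀ X : ℝ → ℝ → Plane, IsAlphaCSF α X →
      (∀ p t, 0 ≤ t → X p t ∈ Metric.ball (0 : Plane) 1 →
        |speedS α X t p| ≤ K * speed α X t p ^ β) →
      (∀ p t, 0 ≤ t → X p t ∈ Metric.ball (0 : Plane) 1 → speed α X t p ≤ L) →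
      ∀ t₁ t₀ p : ℝ, 0 < t₁ → t₁ ≤ t₀ → t₀ ≤ t₁ + 1 → ‖X p t₀‖ ≤ 3 / 4 →
        bernsteinFn α β (min β (2 * β - 1)) l t₁ X t₀ p ≤ C := by
  obtain ⟨γ, hγ⟩ : ∃ γ, γ = min β (2 * β - 1) := ⟨_, rfl⟩
  rw [← hγ]
  have hγ1 : γ ≤ β := hγ ▸ min_le_left _ _
  have hγ2 : γ ≤ 2 * β - 1 := hγ ▸ min_le_right _ _
  obtain ⟨B, hB⟩ : ∃ B, B = max K 1 := ⟨_, rfl⟩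
  have hB1 : 1 ≤ B := hB ▸ le_max_right _ _
  obtain ⟨L₀, hL₀⟩ : ∃ L₀, L₀ = max L 1 := ⟨_, rfl⟩
  have hL₀1 : 1 ≤ L₀ := hL₀ ▸ le_max_right _ _
  have hL₀pos : 0 < L₀ := by linarith
  obtain ⟨M, hM1, hM⟩ := exists_bernstein_alternative (β := β) (γ := γ) hα hB1 hL₀1
  have hM0 : 0 < M := by linarith
  obtain ⟨l, hl⟩ : ∃ l, l = 1 / (4 * B ^ 2) := ⟨_, rfl⟩
  have hl0 : 0 < l := by rw [hl]; positivity
  rw [← hl] at hM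
  -- One summand for each of the three alternatives; the factor e bounds the exponential, whose
  -- exponent is at most lB² = 1/4.
  obtain ⟨C, hC⟩ : ∃ C, C = (M ^ 2 * L₀ ^ (4 * β - 2 - 2 * γ) + M ^ 2 * L₀ ^ (2 * β - 2 * γ)
    + M * L₀ ^ (1 / α - 1 + 2 * β - 2 * γ)) * Real.exp 1 := ⟨_, rfl⟩
  have hC0 : 0 < C := by rw [hC]; positivity
  refine ⟨l, C, hl0, hC0, ?_⟩
  intro X hX hK hL t₁ t₀ p₀ ht₁ ht₁₀ ht₀ hp₀
  have hne : {z : ℝ × ℝ | z.1 ∈ Set.Icc t₁ t₀ ∧ ‖X z.2 z.1‖ ≤ 3 / 4}.Nonempty :=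
    ⟨(t₀, p₀), ⟨ht₁₀, le_rfl⟩, hp₀⟩
  have hcont : ContinuousOn (fun z : ℝ × ℝ => bernsteinFn α β γ l t₁ X z.1 z.2)
      {z : ℝ × ℝ | z.1 ∈ Set.Icc t₁ t₀ ∧ ‖X z.2 z.1‖ ≤ 3 / 4} :=
    (hX.continuousOn_bernsteinFn β γ l t₁).mono fun z hz => ⟨ht₁.trans_le hz.1.1, trivial⟩
  obtain ⟨⟨t, p⟩, hmem, hmax⟩ := (hX.isCompact_setOf_norm_le hL ht₁).exists_isMaxOn hne hcont
  have htt₁ : t₁ ≤ t := hmem.1.1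
  have htt₀ : t ≤ t₀ := hmem.1.2
  have hXp : ‖X p t‖ ≤ 3 / 4 := hmem.2
  have hmax' : ∀ τ q, t₁ ≤ τ → τ ≤ t₀ → ‖X q τ‖ ≤ 3 / 4 →
      bernsteinFn α β γ l t₁ X τ q ≤ bernsteinFn α β γ l t₁ X t p :=
    fun τ q h1 h2 h3 => isMaxOn_iff.1 hmax (τ, q) ⟨⟨h1, h2⟩, h3⟩
  refine (hmax' t₀ p₀ ht₁₀ le_rfl hp₀).trans ?_
  by_contra! hgt
  have hFpos := hC0.trans hgt
  -- Positivity of F excludes the zeros of its factors, so the maximum is neither on the boundary of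
  -- the ball nor at time t₁.
  have hw : speedSS α X t p ≠ 0 := by
    rintro h
    simp [bernsteinFn, h] at hFpos
  have hη : 0 < cutoff X t p := by
    refine lt_of_le_of_ne (cutoff_nonneg hXp) fun h => ?_
    simp [bernsteinFn, ← h] at hFpos
  have ht : t₁ < t := by
    refine lt_of_le_of_ne htt₁ fun h => ?_
    simp [bernsteinFn, ← h] at hFpos
  have htpos := ht₁.trans ht
  have hball : X p t ∈ Metric.ball (0 : Plane) 1 := by
    rw [mem_ball_zero_iff]; linarith
  have hpos := hX.speed_pos (p := p) htpos.le
  have huL : speed α X t p ≤ L₀ := (hL p t htpos.le hball).trans (hL₀ ▸ le_max_left _ _)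
  have hbpos : 0 < speed α X t p ^ β := Real.rpow_pos_of_pos hpos _
  have hv : |speedS α X t p| ≤ B * speed α X t p ^ β :=
    (hK p t htpos.le hball).trans (by gcongr; exact hB ▸ le_max_left _ _)
  have hlog : ∀ τ q, t₁ < τ → τ ≤ t₀ → speedSS α X τ q ≠ 0 → 0 < cutoff X τ q →
      logBernstein α β γ l t₁ X τ q ≤ logBernstein α β γ l t₁ X t p := fun τ q h1 h2 h3 h4 => by
    obtain ⟨e1, e2⟩ := hX.log_bernsteinFn β γ l ht₁ h1 h3 h4
    rw [e2, (hX.log_bernsteinFn β γ l ht₁ ht hw hη).2]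
    exact Real.log_le_log e1 (hmax' τ q h1.le h2 (norm_le_of_cutoff_nonneg h4.le))
  have hmaxp : IsLocalMax (logBernstein α β γ l t₁ X t) p := by
    filter_upwards [(hX.smooth_speedSS.hasDerivAt_dp htpos).continuousAt.eventually_ne hw,
      (hX.smooth_cutoff.hasDerivAt_dp htpos).continuousAt.eventually (lt_mem_nhds hη)] with q h1 h2
      using hlog t q ht htt₀ h1 h2
  have hleft : ∀ᶠ τ in nhdsWithin t (Set.Iio t),
      logBernstein α β γ l t₁ X τ p ≤ logBernstein α β γ l t₁ X t p := by
    filter_upwards [self_mem_nhdsWithin, mem_nhdsWithin_of_mem_nhds (lt_mem_nhds ht),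
      mem_nhdsWithin_of_mem_nhds
        ((hX.smooth_speedSS.hasDerivAt_dt (p := p) htpos).continuousAt.eventually_ne hw),
      mem_nhdsWithin_of_mem_nhds
        ((hX.smooth_cutoff.hasDerivAt_dt (p := p) htpos).continuousAt.eventually
          (lt_mem_nhds hη))] with τ h0 h1 h2 h3
      using hlog τ p h1 ((Set.mem_Iio.1 h0).le.trans htt₀) h2 h3
  have halt := hM X hX t₁ t p ht₁ ht hw hη huL hv hmaxp hleft
  refine absurd hgt (not_lt.2 ?_)
  have hT : 0 < t - t₁ := sub_pos.2 ht
  have hT1 : t - t₁ ≤ 1 := by linarith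
  have hη1 := cutoff_le_one X t p
  have hη2 : cutoff X t p ^ 2 ≤ 1 := pow_le_one₀ hη.le hη1
  have hexp : Real.exp (l * (speedS α X t p ^ 2 * speed α X t p ^ (-2 * β))) ≤ Real.exp 1 := by
    refine Real.exp_le_exp.2 ?_
    have e1 : speed α X t p ^ (-2 * β) = ((speed α X t p ^ β) ^ 2)⁻¹ := by
      rw [neg_mul, Real.rpow_neg hpos.le, mul_comm, Real.rpow_mul hpos.le, Real.rpow_two]
    have e2 : speedS α X t p ^ 2 ≤ B ^ 2 * (speed α X t p ^ β) ^ 2 := by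
      rw [← sq_abs, ← mul_pow]; gcongr
    rw [e1, ← div_eq_mul_inv]
    calc l * (speedS α X t p ^ 2 / (speed α X t p ^ β) ^ 2) ≤ l * B ^ 2 := by
          gcongr; rwa [div_le_iff₀ (by positivity)]
      _ = 1 / 4 := by rw [hl]; field_simp
      _ ≤ 1 := by norm_num
  rw [bernsteinFn, hC]
  refine mul_le_mul ?_ hexp (Real.exp_pos _).le (by positivity)
  obtain ⟨W, hW⟩ : ∃ W, W = speedSS α X t p / speed α X t p ^ β := ⟨_, rfl⟩
  have hwW : speedSS α X t p ^ 2 * speed α X t p ^ (-2 * γ)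
      = W ^ 2 * speed α X t p ^ (2 * β - 2 * γ) := by
    rw [hW, show 2 * β - 2 * γ = β + β + -2 * γ by ring, Real.rpow_add hpos, Real.rpow_add hpos]
    field_simp
  rw [← hW] at halt
  rw [hwW]
  have p1 : 0 ≤ M ^ 2 * L₀ ^ (4 * β - 2 - 2 * γ) := by positivity
  have p2 : 0 ≤ M ^ 2 * L₀ ^ (2 * β - 2 * γ) := by positivity
  have p3 : 0 ≤ M * L₀ ^ (1 / α - 1 + 2 * β - 2 * γ) := by positivity
  have hE0 : 0 < speed α X t p ^ (2 * β - 2 * γ) := Real.rpow_pos_of_pos hpos _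
  rcases halt with h | h | h
  · have h1 : W ^ 2 ≤ (M * (speed α X t p ^ β / speed α X t p)) ^ 2 := by
      rw [← sq_abs]; gcongr
    have h2 : (speed α X t p ^ β / speed α X t p) ^ 2 * speed α X t p ^ (2 * β - 2 * γ)
        = speed α X t p ^ (4 * β - 2 - 2 * γ) := by
      rw [← Real.rpow_sub_one hpos.ne', ← Real.rpow_two, ← Real.rpow_mul hpos.le,
        ← Real.rpow_add hpos]
      congr 1; ring
    calc cutoff X t p ^ 2 * (t - t₁) * (W ^ 2 * speed α X t p ^ (2 * β - 2 * γ))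
        ≤ 1 * 1 * ((M * (speed α X t p ^ β / speed α X t p)) ^ 2
          * speed α X t p ^ (2 * β - 2 * γ)) := by gcongr
      _ = M ^ 2 * speed α X t p ^ (4 * β - 2 - 2 * γ) := by rw [← h2]; ring
      -- The exponent is nonnegative because γ ≤ 2β-1; in the second case γ ≤ β serves.
      _ ≤ M ^ 2 * L₀ ^ (4 * β - 2 - 2 * γ) := by gcongr; linarith
      _ ≤ _ := by linarith
  · have h1 : cutoff X t p ^ 2 * W ^ 2 ≤ M ^ 2 := by
      rw [← sq_abs W, ← mul_pow]; gcongr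
    calc cutoff X t p ^ 2 * (t - t₁) * (W ^ 2 * speed α X t p ^ (2 * β - 2 * γ))
        = (t - t₁) * ((cutoff X t p ^ 2 * W ^ 2) * speed α X t p ^ (2 * β - 2 * γ)) := by ring
      _ ≤ 1 * (M ^ 2 * L₀ ^ (2 * β - 2 * γ)) := by gcongr; linarith
      _ ≤ _ := by linarith
  · have h2 : speed α X t p ^ (2 * β - 2 * γ) = speed α X t p ^ (1 - 1 / α) *
        speed α X t p ^ (1 / α - 1 + 2 * β - 2 * γ) := by
      rw [← Real.rpow_add hpos]
      congr 1; ring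
    calc cutoff X t p ^ 2 * (t - t₁) * (W ^ 2 * speed α X t p ^ (2 * β - 2 * γ))
        = cutoff X t p ^ 2 * (((t - t₁) * speed α X t p ^ (1 - 1 / α) * W ^ 2) *
            speed α X t p ^ (1 / α - 1 + 2 * β - 2 * γ)) := by rw [h2]; ring
      -- Adding γ ≤ β and γ ≤ 2β-1 bounds this exponent below by 1/α - β, which is positive.
      _ ≤ 1 * (M * L₀ ^ (1 / α - 1 + 2 * β - 2 * γ)) := by
          gcongr; linarith
      _ ≤ _ := by linarith

end IsAlphaCSF

/-! ### The theorem -/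

theorem proposition3p4 (α : ℝ) (hα : 1 / 3 ≤ α) (β : ℝ) (hβ₀ : 0 < β) (hβ : β < 1 / α)
    (ε : ℝ) (hε₀ : 0 < ε) (hε : ε < min 1 β) (K L : ℝ) :
    ∃ C : ℝ, 0 < C ∧ ∀ X : ℝ → ℝ → Plane,
      IsAlphaCSF α X → EndsAsymptoticToLines (fun p => X p 0) →
      (∀ p t, 0 ≤ t → X p t ∈ Metric.ball (0 : Plane) 1 →
        |speedS α X t p| ≤ K * speed α X t p ^ β) →
      (∀ p t, 0 ≤ t → X p t ∈ Metric.ball (0 : Plane) 1 → speed α X t p ≤ L) →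
      ∀ p t, 0 < t → X p t ∈ Metric.ball (0 : Plane) (1 / 2) →
        |speedSS α X t p| ≤
          C * (1 + t ^ (-(1 / 2) : ℝ)) * speed α X t p ^ (min β (2 * β - 1) - ε) := by
  have hα0 : 0 < α := by linarith
  obtain ⟨l, C, hl, hC, hbound⟩ := IsAlphaCSF.exists_bernstein_bound hα0 hβ K L
  set γ := min β (2 * β - 1)
  have hL₀ : 0 < max L 1 := lt_max_of_lt_right one_pos
  -- The cutoff is at least 5/16 on the ball of radius 1/2, the 2 comes from 1 ≤ 2τ(1 + t^(-1/2))²,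
  -- and the last factor absorbs u^ε.
  refine ⟨16 / 5 * √(2 * C) * max L 1 ^ ε, by positivity, fun X hX _ hK hL p t ht hp => ?_⟩
  rw [mem_ball_zero_iff] at hp
  have hpos := hX.speed_pos (p := p) ht.le
  -- The estimate starts at t - τ: positive, where the flow is smooth, and at most one time unit
  -- back.
  obtain ⟨τ, hτ⟩ : ∃ τ, τ = min 1 (t / 2) := ⟨_, rfl⟩
  have hτ0 : 0 < τ := by rw [hτ]; positivity
  have hτ1 : τ ≤ 1 := hτ ▸ min_le_left _ _
  have hτ2 : τ ≤ t / 2 := hτ ▸ min_le_right _ _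
  have hF := hbound X hX hK hL (t - τ) t p (by linarith) (by linarith) (by linarith) (by linarith)
  have hη : 5 / 16 ≤ cutoff X t p := by
    rw [cutoff]; nlinarith [norm_nonneg (X p t)]
  have hs : 1 ≤ τ * (2 * (1 + t ^ (-(1 / 2) : ℝ)) ^ 2) := by
    have h1 : (t ^ (-(1 / 2) : ℝ)) ^ 2 = t⁻¹ := by
      rw [← Real.rpow_two, ← Real.rpow_mul ht.le]
      norm_num [Real.rpow_neg_one]
    have h2 : 0 < t ^ (-(1 / 2) : ℝ) := Real.rpow_pos_of_pos ht _
    have h3 : 1 + t⁻¹ ≤ (1 + t ^ (-(1 / 2) : ℝ)) ^ 2 := by rw [← h1]; nlinarith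
    have h4 : 1 ≤ τ * (2 * (1 + t⁻¹)) := by
      have h5 : 0 < t⁻¹ := by positivity
      have h6 : t * t⁻¹ = 1 := mul_inv_cancel₀ ht.ne'
      rw [hτ]
      rcases min_cases 1 (t / 2) with ⟨h, _⟩ | ⟨h, _⟩ <;> rw [h] <;> nlinarith
    exact h4.trans (by gcongr)
  obtain ⟨s, hsdef⟩ : ∃ s, s = 1 + t ^ (-(1 / 2) : ℝ) := ⟨_, rfl⟩
  have hs0 : 0 < s := by rw [hsdef]; positivity
  rw [← hsdef] at hs ⊢
  obtain ⟨D, hD⟩ : ∃ D, D = speed α X t p ^ γ := ⟨_, rfl⟩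
  have hD0 : 0 < D := by rw [hD]; exact Real.rpow_pos_of_pos hpos _
  have hDinv : speed α X t p ^ (-2 * γ) = (D ^ 2)⁻¹ := by
    rw [hD, neg_mul, Real.rpow_neg hpos.le, mul_comm, Real.rpow_mul hpos.le, Real.rpow_two]
  have hDle : D ≤ max L 1 ^ ε * speed α X t p ^ (γ - ε) := by
    have h1 : speed α X t p ≤ max L 1 :=
      (hL p t ht.le (by rw [mem_ball_zero_iff]; linarith)).trans (le_max_left _ _)
    calc D = speed α X t p ^ ε * speed α X t p ^ (γ - ε) := by
          rw [hD, ← Real.rpow_add hpos]; congr 1; ring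
      _ ≤ _ := by gcongr
  have hw : speedSS α X t p ^ 2 ≤ (16 / 5 * √(2 * C) * s * D) ^ 2 := by
    rw [bernsteinFn, hDinv, sub_sub_cancel] at hF
    have h1 : (5 / 16 : ℝ) ^ 2 * τ * (speedSS α X t p ^ 2 * (D ^ 2)⁻¹) * 1 ≤ C :=
      le_trans (by
        gcongr
        exact Real.one_le_exp (mul_nonneg hl.le (by positivity))) hF
    rw [mul_one, ← div_eq_mul_inv, mul_div_assoc', div_le_iff₀ (by positivity)] at h1
    rw [mul_pow, mul_pow, mul_pow, Real.sq_sqrt (by positivity)]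
    have h2 : speedSS α X t p ^ 2 * 1 ≤ speedSS α X t p ^ 2 * (τ * (2 * s ^ 2)) := by gcongr
    have h3 := mul_le_mul_of_nonneg_right h1 (show 0 ≤ 2 * s ^ 2 by positivity)
    linarith
  calc |speedSS α X t p| ≤ 16 / 5 * √(2 * C) * s * D := abs_le_of_sq_le_sq hw (by positivity)
    _ ≤ 16 / 5 * √(2 * C) * s * (max L 1 ^ ε * speed α X t p ^ (γ - ε)) := by gcongr
    _ = _ := by ring
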